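/- Let $0<q<1$, $g>0$, $\ell=q^{-g}$. Write $(a;q)_n=\prod_{k=0}^{n-1}(1-aq^k)$, $(a;q)_\infty=\prod_{k\ge0}(1-aq^k)$, $(a_1,\dots,a_m;q)_n=\prod_i(a_i;q)_n$ for $n\in\mathbb Z_{\ge0}\cup\{\infty\}$, $\Gamma_q(z)=\frac{(q;q)_\infty}{(q^z;q)_\infty(1-q)^{z-1}}$, $B_q(a,b)=\frac{\Gamma_q(a)\Gamma_q(b)}{\Gamma_q(a+b)}$ and $\mathcal L_q(\nu;u,v)=(\nu uv,\nu uv^{-1},\nu u^{-1}v,\nu u^{-1}v^{-1};q)_\infty$. Let $\mathrm{Sym}(t_1,t_2;t_3)$ be the space of complex Laurent polynomials in $t_1,t_2,t_3$ that are symmetric under $t_1\leftrightarrow t_2$, and define $\mathrm{Sym}(y_1,y_2;x)$ likewise. For nonzero $x,y_+,y_-\in\mathbb C$ put $y_1=y_+y_-$, $y_2=y_+/y_-$ and $t_+=\ell^{3/2}y_+$. The integral operator $M$ sends $\Psi(t_1,t_2,t_3)$ to $$(M\Psi)(x,y_1,y_2)=\frac1{2\pi i}\int_\Gamma\frac{dt}{t}\,\mathcal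 M(y_+,y_-\mid t)\,\Psi\bigl(\ell^{3/2}xy_+t,\ \ell^{3/2}xy_+t^{-1},\ x\bigr),$$ $$\mathcal M(y_+,y_-\mid t)=\frac{(1-q)(q;q)_\infty^2\,(t^2,t^{-2};q)_\infty\,\mathcal L_q(\ell^{-3/2};y_-,t_+)}{2B_q(g,2g)\,\mathcal L_q(\ell^{-1/2};y_-,t)\,\mathcal L_q(\ell^{-1};t,t_+)}.$$ Here $\Gamma$ is the following cycle. Let $A=\{y_-q^{g/2},\,y_-^{-1}q^{g/2},\,t_+q^{g},\,t_+^{-1}q^{g}\}$ and let $C_{z,r}$ be the counter-clockwise circle of centre $z$ and radius $r$. Then $$\Gamma=C_{0,1}+\sum_{p}\bigl(C_{p,\varepsilon}-C_{p^{-1},\varepsilon}\bigr),$$ the sum being over the finitely many distinct points $p=aq^k$ with $a\in A$, $k\ge0$, $|p|>1$. The radius $\varepsilon>0$ is so small that each closed disc bounded by one of these small circles avoids $0$ and contains no point $a^{\pm1}q^{\pm k}$ ($a\in A$, $k\ge 0$, equal signs) other than its centre. The point $(y_+,y_-)$ is assumed generic: $|a|q^k\ne1$ and $abq^k\neq1$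 for all $a,b\in A$ (possibly equal) and all integers $k\ge0$. For $j,k\in\mathbb Z$ and $\nu\in\mathbb Z_{\ge0}$ let $$p_{jk\nu}=t_3^{\,j-2k}(t_1t_2)^k\bigl(\ell^{-1}t_1t_3^{-1},\ell^{-1}t_2t_3^{-1};q\bigr)_\nu,\qquad \tilde p_{jk\nu}=x^j(y_1y_2)^k(y_1,y_2;q)_\nu .$$ **Theorem.** The $p_{jk\nu}$ form a basis of $\mathrm{Sym}(t_1,t_2;t_3)$ and the $\tilde p_{jk\nu}$ form a basis of $\mathrm{Sym}(y_1,y_2;x)$. The operator $M$ defines a linear map $\mathrm{Sym}(t_1,t_2;t_3)\to\mathrm{Sym}(y_1,y_2;x)$ (that is, for each $\Psi$ in the first space, $M\Psi$ agrees with an element of the second space, depending linearly on $\Psi$, at all generic points and for all admissible $\varepsilon$), and this map is diagonal in these bases: $$M\,p_{jk\nu}=\ell^{3k}\,\frac{(\ell^{-2};q)_\nu}{(\ell^{-3};q)_\nu}\;\tilde p_{jk\nu}\qquad(j,k\in\mathbb Z,\ \nu\in\mathbb Z_{\ge0}).$$ -/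

import Mathlib

noncomputable section

namespace RuijsenaarsA2

/-! ### q-analysis -/

/-- The finite `q`-shifted factorial `(a;q)_n = ∏_{k<n} (1 - a q^k)`, with `a` in a commutative
`ℂ`-algebra. -/
def qPoch {R : Type*} [CommRing R] [Algebra ℂ R] (a : R) (q : ℝ) (n : ℕ) : R :=
  ∏ k ∈ Finset.range n, (1 - ((q : ℂ) ^ k) • a)

/-- The infinite `q`-shifted factorial `(a;q)_∞ = ∏_{k≥0} (1 - a q^k)`. -/
def qPochInf (a : ℂ) (q : ℝ) : ℂ :=
  ∏' k : ℕ, (1 - a * (q : ℂ) ^ k)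

/-- The `q`-Gamma function `Γ_q(z) = (q;q)_∞ / ((q^z;q)_∞ (1-q)^{z-1})`, for real `z`. -/
def qGamma (q z : ℝ) : ℂ :=
  qPochInf (q : ℂ) q / (qPochInf ((q ^ z : ℝ) : ℂ) q * (((1 - q) ^ (z - 1) : ℝ) : ℂ))

/-- The `q`-Beta function `B_q(a,b) = Γ_q(a) Γ_q(b) / Γ_q(a+b)`. -/
def qBeta (q a b : ℝ) : ℂ :=
  qGamma q a * qGamma q b / qGamma q (a + b)

/-- `L_q(ν; x, y) = (ν x y, ν x y⁻¹, ν x⁻¹ y, ν x⁻¹ y⁻¹; q)_∞`. -/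
def Lq (q : ℝ) (ν x y : ℂ) : ℂ :=
  qPochInf (ν * x * y) q * qPochInf (ν * x * y⁻¹) q *
    qPochInf (ν * x⁻¹ * y) q * qPochInf (ν * x⁻¹ * y⁻¹) q

/-- The coupling parameter `ℓ = q^{-g}`. -/
def ell (q g : ℝ) : ℝ := q ^ (-g)

/-! ### The Askey-Wilson cycle -/

/-- The points `x q^k` (`x` one of the four parameters, `k ≥ 0`) lying outside the unit circle. -/
def outerPoles (prm : Fin 4 → ℂ) (q : ℝ) : Set ℂ :=
  {p | ∃ (i : Fin 4) (k : ℕ), p = prm i * (q : ℂ) ^ k ∧ 1 < ‖prm i * (q : ℂ) ^ k‖}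

/-- All zeros `x q^k`, `x⁻¹ q^{-k}` of the denominator
`∏_x (x t, x t⁻¹; q)_∞` of the Askey-Wilson weight. -/
def denominatorZeros (prm : Fin 4 → ℂ) (q : ℝ) : Set ℂ :=
  {p | ∃ (i : Fin 4) (k : ℕ), p = prm i * (q : ℂ) ^ k ∨ p = (prm i * (q : ℂ) ^ k)⁻¹}

/-- The parameters are in general position: no zero of the denominator lies on the unit circle,
and no point `x q^j` coincides with a point `y⁻¹ q^{-k}`, where `x`, `y` are among the four
parameters. -/
def GenericParams (prm : Fin 4 → ℂ) (q : ℝ) : Prop :=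
  (∀ (i : Fin 4) (k : ℕ), ‖prm i * (q : ℂ) ^ k‖ ≠ 1) ∧
  (∀ (i j : Fin 4) (k : ℕ), prm i * prm j * (q : ℂ) ^ k ≠ 1)

/-- `ε > 0` is so small that each of the closed discs of radius `ε` about `p` and `p⁻¹`,
`p` an outer pole, avoids `0` and contains only one zero of the denominator, its centre. -/
def SmallRadius (prm : Fin 4 → ℂ) (q ε : ℝ) : Prop :=
  0 < ε ∧ ∀ p ∈ outerPoles prm q, ∀ c : ℂ, c = p ∨ c = p⁻¹ →
    (0 : ℂ) ∉ Metric.closedBall c ε ∧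
    ∀ w ∈ denominatorZeros prm q, w ∈ Metric.closedBall c ε → w = c

/-- The integral over the cycle
`Γ = C_{0,1} + ∑_p (C_{p,ε} - C_{p⁻¹,ε})`, `p` running over the finitely many distinct points
`x q^k` with `|x| q^k > 1`; here `C_{z,r}` is the counter-clockwise circle of centre `z` and
radius `r`. -/
def cycleIntegral (prm : Fin 4 → ℂ) (q ε : ℝ) (F : ℂ → ℂ) : ℂ :=
  (∮ t in C(0, 1), F t) +
    ∑ᶠ p ∈ outerPoles prm q, ((∮ t in C(p, ε), F t) - ∮ t in C(p⁻¹, ε), F t)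

/-- The parameters `s q^{α/2}, s⁻¹ q^{α/2}, r q^{β/2}, r⁻¹ q^{β/2}` defining the
cycle `Γ_{α,β}^{r,s}`. -/
def cycleParams (q α β : ℝ) (r s : ℂ) : Fin 4 → ℂ :=
  ![s * ((q ^ (α / 2) : ℝ) : ℂ), s⁻¹ * ((q ^ (α / 2) : ℝ) : ℂ),
    r * ((q ^ (β / 2) : ℝ) : ℂ), r⁻¹ * ((q ^ (β / 2) : ℝ) : ℂ)]

/-! ### The operator `M` -/

/-- The value `t₊ = ℓ^{3/2} y₊`. -/
def tPlus (q g : ℝ) (yp : ℂ) : ℂ := yp * ((ell q g ^ (3 / 2 : ℝ) : ℝ) : ℂ)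

/-- The parameters of the cycle `Γ_{g,2g}^{t₊,y₋}` of the operator `M`. -/
def paramsM (q g : ℝ) (yp ym : ℂ) : Fin 4 → ℂ :=
  cycleParams q g (2 * g) (tPlus q g yp) ym

/-- The kernel `𝓜(y₊, y₋ ∣ t₋)`. -/
def kernelM (q g : ℝ) (yp ym t : ℂ) : ℂ :=
  ((1 - q : ℝ) : ℂ) * qPochInf (q : ℂ) q ^ 2 * (qPochInf (t ^ 2) q * qPochInf ((t⁻¹) ^ 2) q) *
      Lq q ((ell q g ^ (-(3 / 2) : ℝ) : ℝ) : ℂ) ym (tPlus q g yp) /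
    (2 * qBeta q g (2 * g) * Lq q ((ell q g ^ (-(1 / 2) : ℝ) : ℝ) : ℂ) ym t *
      Lq q ((ell q g : ℂ)⁻¹) t (tPlus q g yp))

/-- The integral operator `M`. For a function `Ψ(t₁, t₂, t₃)` this is the value of `M Ψ` at the
point `(x, y₁, y₂)` with `y₁ = y₊ y₋`, `y₂ = y₊ / y₋`:
`(1/2πi) ∫_Γ (dt₋/t₋) 𝓜(y₊, y₋ ∣ t₋) Ψ(ℓ^{3/2} x y₊ t₋, ℓ^{3/2} x y₊ t₋⁻¹, x)`. -/
def opM (q g ε : ℝ) (Ψ : (Fin 3 → ℂ) → ℂ) (x yp ym : ℂ) : ℂ :=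
  (2 * (Real.pi : ℂ) * Complex.I)⁻¹ *
    cycleIntegral (paramsM q g yp ym) q ε fun t =>
      t⁻¹ * (kernelM q g yp ym t *
        Ψ ![tPlus q g yp * x * t, tPlus q g yp * x * t⁻¹, x])

/-! ### Laurent polynomials -/

/-- Complex Laurent polynomials in three variables, indexed by `0, 1, 2`. -/
abbrev Laurent3 : Type := AddMonoidAlgebra ℂ (Fin 3 → ℤ)

/-- The Laurent monomial `z₀^a z₁^b z₂^c`. -/
def mono (a b c : ℤ) : Laurent3 := AddMonoidAlgebra.single ![a, b, c] 1

/-- The value of a Laurent polynomial at a point (with nonzero coordinates). -/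
def evalL (f : Laurent3) (z : Fin 3 → ℂ) : ℂ :=
  f.coeff.sum fun n c => c * ∏ i, z i ^ n i

/-- `Sym(z₀, z₁; z₂)`: the Laurent polynomials in `z₀, z₁, z₂` symmetric with respect to
`z₀ ↔ z₁`. For `(z₀, z₁, z₂) = (t₁, t₂, t₃)` it is `Sym(t₁, t₂; t₃)`, and for
`(z₀, z₁, z₂) = (y₁, y₂, x)` it is `Sym(y₁, y₂; x)`. -/
def Sym12 : Submodule ℂ Laurent3 where
  carrier := {f | ∀ a b c : ℤ, f.coeff ![a, b, c] = f.coeff ![b, a, c]}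
  zero_mem' := by intro a b c; simp
  add_mem' := by
    intro f g hf hg a b c
    simp [hf a b c, hg a b c]
  smul_mem' := by
    intro r f hf a b c
    simp [hf a b c]

/-- `p_{jkν} = t₃^{j-2k} (t₁ t₂)^k (ℓ⁻¹ t₁ t₃⁻¹, ℓ⁻¹ t₂ t₃⁻¹; q)_ν`, in the
variables `(z₀, z₁, z₂) = (t₁, t₂, t₃)`. -/
def pT (q g : ℝ) (j k : ℤ) (ν : ℕ) : Laurent3 :=
  mono k k (j - 2 * k) *
    (qPoch (((ell q g : ℂ)⁻¹) • mono 1 0 (-1)) q ν *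
      qPoch (((ell q g : ℂ)⁻¹) • mono 0 1 (-1)) q ν)

/-- `p̃_{jkν} = x^j (y₁ y₂)^k (y₁, y₂; q)_ν`, in the variables
`(z₀, z₁, z₂) = (y₁, y₂, x)`. -/
def pY (q : ℝ) (j k : ℤ) (ν : ℕ) : Laurent3 :=
  mono k k j * (qPoch (mono 1 0 0) q ν * qPoch (mono 0 1 0) q ν)

end RuijsenaarsA2

end

open RuijsenaarsA2

/-!
# The integral operator `M` is diagonal in the bases `p_{jkν}` and `p̃_{jkν}`

Up to a constant the kernel of `M` is the Askey-Wilson weight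
`w(t) = (t², t⁻²; q)_∞ / ∏_i (a_i t, a_i t⁻¹; q)_∞` with the four parameters `paramsM`. At the point
where `p_{jkν}` is evaluated in the integrand it equals `x^j t₊^{2k} (a₂ t, a₂ t⁻¹; q)_ν`, and the
last factor turns `w` into the weight with `a₂` replaced by `a₂ q^ν` (`awWeight_update`). So
`M p_{jkν}` is again an Askey-Wilson integral, and the eigenvalue is a quotient of two values of the
Askey-Wilson formula (`opM_pT`); a general `Ψ` follows by linearity.

The Askey-Wilson formula for the cycle `Γ` (`cycleRes_awWeight`) is obtained as follows.

* With `A(t) = t⁻¹ (qt², t⁻²; q)_∞ / ∏_i (q a_i t, a_i t⁻¹; q)_∞` the difference `A(t) - A(t/q)` is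
  `w(t)` times a polynomial of degree one in `t + t⁻¹` (`awPotential_sub`).
* The integrals over `Γ` of `A(t) dt/t` and `A(t/q) dt/t` agree (`cycleRes_dilation`): this is the
  residue theorem in the annulus `1 < |t| < 1/q`, combined with the bookkeeping of the residues
  at the outer poles. For this the small circles in `Γ` are written as residues, which also allows
  coinciding parameters and hence poles of higher order.
* It follows that the integral, divided by its expected value, is unchanged when a parameter is
  multiplied by `q` (`normalizedAW_update`). Letting all parameters tend to `0` along powers of `q`,
  it does not depend on them at all (`normalizedAW_eq`).
* The remaining constant is read off at `q, -q, √q, -√q`, where `w(t) = (1 - t²)(1 - t⁻²)`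
  (`circleIntegral_awWeight_zero`).

Both families are bases of the symmetric Laurent polynomials because they are triangular with
respect to the coefficients of `z₀^{k+ν} z₁^k z₂^c` (`exists_basis_symProd`).
-/

noncomputable section

namespace RuijsenaarsA2

open Filter Topology Set Metric

/-! ### Infinite `q`-products -/

lemma norm_ofReal_lt_one {q : ℝ} (hq0 : 0 < q) (hq1 : q < 1) : ‖(q : ℂ)‖ < 1 := by
  rwa [Complex.norm_real, Real.norm_of_nonneg hq0.le]

lemma summable_qPochInf {q : ℝ} (hq0 : 0 < q) (hq1 : q < 1) (a : ℂ) :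
    Summable fun k : ℕ => ‖-(a * (q : ℂ) ^ k)‖ := by
  simp only [norm_neg, norm_mul, norm_pow]
  exact (summable_geometric_of_lt_one (norm_nonneg _) (norm_ofReal_lt_one hq0 hq1)).mul_left _

lemma multipliable_qPochInf {q : ℝ} (hq0 : 0 < q) (hq1 : q < 1) (a : ℂ) :
    Multipliable fun k : ℕ => (1 - a * (q : ℂ) ^ k) := by
  simpa [sub_eq_add_neg] using multipliable_one_add_of_summable (summable_qPochInf hq0 hq1 a)

lemma qPochInf_eq_mul {q : ℝ} (hq0 : 0 < q) (hq1 : q < 1) (a : ℂ) :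
    qPochInf a q = (1 - a) * qPochInf (a * q) q := by
  have h := (multipliable_qPochInf hq0 hq1 (a * q))
  unfold qPochInf
  rw [tprod_eq_zero_mul' (f := fun k : ℕ => (1 - a * (q : ℂ) ^ k))]
  · simp [pow_succ', mul_assoc]
  · simpa [pow_succ', mul_assoc] using h

lemma qPochInf_ne_zero {q : ℝ} (hq0 : 0 < q) (hq1 : q < 1) {a : ℂ}
    (h : ∀ k : ℕ, a * (q : ℂ) ^ k ≠ 1) : qPochInf a q ≠ 0 := by
  have := tprod_one_add_ne_zero_of_summable (f := fun k : ℕ => -(a * (q : ℂ) ^ k))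
    (fun k => by rw [← sub_eq_add_neg, sub_ne_zero]; exact (h k).symm)
    (summable_qPochInf hq0 hq1 a)
  simpa [qPochInf, sub_eq_add_neg] using this

lemma mul_pow_ne_one_of_norm_lt_one {q : ℝ} (hq0 : 0 < q) (hq1 : q < 1) {a : ℂ} (ha : ‖a‖ < 1)
    (k : ℕ) : a * (q : ℂ) ^ k ≠ 1 := by
  intro h
  have h1 : ‖a * (q : ℂ) ^ k‖ < 1 := by
    rw [norm_mul, norm_pow]
    calc ‖a‖ * ‖(q : ℂ)‖ ^ k ≤ ‖a‖ * 1 := by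
          gcongr
          exact pow_le_one₀ (norm_nonneg _) (norm_ofReal_lt_one hq0 hq1).le
      _ < 1 := by simpa
  rw [h] at h1
  simp at h1

lemma qPochInf_ne_zero_of_norm_lt_one {q : ℝ} (hq0 : 0 < q) (hq1 : q < 1) {a : ℂ} (h : ‖a‖ < 1) :
    qPochInf a q ≠ 0 :=
  qPochInf_ne_zero hq0 hq1 (mul_pow_ne_one_of_norm_lt_one hq0 hq1 h)

lemma qPochInf_zero (q : ℝ) : qPochInf 0 q = 1 := by simp [qPochInf]

lemma qPoch_succ (a : ℂ) (q : ℝ) (n : ℕ) :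
    qPoch a q (n + 1) = qPoch a q n * (1 - a * (q : ℂ) ^ n) := by
  simp [qPoch, Finset.prod_range_succ, mul_comm]

lemma qPochInf_eq_qPoch_mul {q : ℝ} (hq0 : 0 < q) (hq1 : q < 1) (a : ℂ) (n : ℕ) :
    qPochInf a q = qPoch a q n * qPochInf (a * (q : ℂ) ^ n) q := by
  induction n with
  | zero => simp [qPoch]
  | succ n ih =>
    rw [ih, qPochInf_eq_mul hq0 hq1 (a * (q : ℂ) ^ n), qPoch_succ, pow_succ]
    simp only [mul_assoc]

lemma differentiable_qPochInf {q : ℝ} (hq0 : 0 < q) (hq1 : q < 1) :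
    Differentiable ℂ fun a : ℂ => qPochInf a q := by
  intro a
  have h := Summable.hasProdLocallyUniformlyOn_one_add (K := ball (0 : ℂ) (‖a‖ + 1))
    (f := fun (k : ℕ) (z : ℂ) => -(z * (q : ℂ) ^ k)) (u := fun k => (‖a‖ + 1) * ‖(q : ℂ)‖ ^ k)
    isOpen_ball
    ((summable_geometric_of_lt_one (norm_nonneg _) (norm_ofReal_lt_one hq0 hq1)).mul_left _)
    (Eventually.of_forall fun k z hz => by
      rw [norm_neg, norm_mul, norm_pow]
      have : ‖z‖ ≤ ‖a‖ + 1 := (mem_ball_zero_iff.mp hz).le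
      gcongr)
    (fun k => by fun_prop)
  have h2 := (hasProdLocallyUniformlyOn_iff_tendstoLocallyUniformlyOn.mp h).differentiableOn
    (Eventually.of_forall fun s => by fun_prop) isOpen_ball
  have h3 := (h2 a (by simp)).differentiableAt (isOpen_ball.mem_nhds (by simp))
  simpa [qPochInf, sub_eq_add_neg] using h3

lemma analyticAt_qPochInf_comp {q : ℝ} (hq0 : 0 < q) (hq1 : q < 1) {f : ℂ → ℂ} {z : ℂ}
    (hf : AnalyticAt ℂ f z) : AnalyticAt ℂ (fun t => qPochInf (f t) q) z :=
  ((differentiable_qPochInf hq0 hq1).analyticAt (f z)).comp hf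

/-- Pairing the `k`-th factors, `(a;q)_∞ (-a;q)_∞ = (a²;q²)_∞`. -/
lemma qPochInf_mul_neg {q : ℝ} (hq0 : 0 < q) (hq1 : q < 1) (a : ℂ) :
    qPochInf a q * qPochInf (-a) q = qPochInf (a ^ 2) (q ^ 2) := by
  unfold qPochInf
  rw [← (multipliable_qPochInf hq0 hq1 a).tprod_mul (multipliable_qPochInf hq0 hq1 (-a))]
  congr 1
  ext k
  push_cast
  ring

/-- Splitting the factors by the parity of `k`, `(a;q²)_∞ (aq;q²)_∞ = (a;q)_∞`. -/
lemma qPochInf_sq_mul {q : ℝ} (hq0 : 0 < q) (hq1 : q < 1) (a : ℂ) :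
    qPochInf a (q ^ 2) * qPochInf (a * q) (q ^ 2) = qPochInf a q := by
  have hq2 : q ^ 2 < 1 := by nlinarith
  unfold qPochInf
  rw [← tprod_even_mul_odd (f := fun k : ℕ => (1 - a * (q : ℂ) ^ k))]
  · congr 1 <;> congr 1 <;> ext k <;> push_cast <;> ring
  · convert multipliable_qPochInf (pow_pos hq0 2) hq2 a using 3
    push_cast; ring
  · convert multipliable_qPochInf (pow_pos hq0 2) hq2 (a * q) using 3
    push_cast; ring

/-! ### Residues and the residue theorem in an annulus -/

/-- `2πi` times the residue of `f` at `p`: the integral of `f` over small circles about `p`. -/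
def circleRes (f : ℂ → ℂ) (p : ℂ) : ℂ :=
  limUnder (𝓝[>] (0 : ℝ)) fun ε => ∮ z in C(p, ε), f z

/-- Once the punctured closed disc contains no singularity, the circle integral is the residue. -/
lemma circleIntegral_eq_circleRes {f : ℂ → ℂ} {p : ℂ} {ρ : ℝ} (hρ : 0 < ρ)
    (hf : ∀ z ∈ closedBall p ρ, z ≠ p → DifferentiableAt ℂ f z) :
    (∮ z in C(p, ρ), f z) = circleRes f p := by
  symm
  refine Tendsto.limUnder_eq (tendsto_const_nhds.congr' ?_)
  filter_upwards [Ioc_mem_nhdsGT hρ] with ε hε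
  refine Complex.circleIntegral_eq_of_differentiable_on_annulus_off_countable hε.1 hε.2
    countable_empty ?_ ?_
  · intro z hz
    refine (hf z hz.1 ?_).continuousAt.continuousWithinAt
    rintro rfl
    exact hz.2 (mem_ball_self hε.1)
  · rintro z ⟨⟨hz1, hz2⟩, -⟩
    refine hf z (ball_subset_closedBall hz1) ?_
    rintro rfl
    exact hz2 (mem_closedBall_self hε.1.le)

lemma eventually_circleIntegral_eq_circleRes {f : ℂ → ℂ} {p : ℂ}
    (hf : ∀ᶠ z in 𝓝[≠] p, DifferentiableAt ℂ f z) :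
    ∀ᶠ ρ in 𝓝[>] (0 : ℝ), (∀ z ∈ closedBall p ρ, z ≠ p → DifferentiableAt ℂ f z) ∧
      (∮ z in C(p, ρ), f z) = circleRes f p := by
  rw [eventually_nhdsWithin_iff, Metric.eventually_nhds_iff] at hf
  obtain ⟨δ, hδ, h⟩ := hf
  filter_upwards [Ioo_mem_nhdsGT hδ] with ρ hρ
  have h' : ∀ z ∈ closedBall p ρ, z ≠ p → DifferentiableAt ℂ f z := fun z hz hzp =>
    h (lt_of_le_of_lt hz hρ.2) hzp
  exact ⟨h', circleIntegral_eq_circleRes hρ.1 h'⟩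

lemma circleRes_eq_zero {f : ℂ → ℂ} {p : ℂ} (hf : AnalyticAt ℂ f p) : circleRes f p = 0 := by
  have h1 : ∀ᶠ z in 𝓝 p, DifferentiableAt ℂ f z :=
    hf.eventually_analyticAt.mono fun z hz => hz.differentiableAt
  obtain ⟨ρ, ⟨h2, h3⟩, h4⟩ := ((eventually_circleIntegral_eq_circleRes
    (h1.filter_mono nhdsWithin_le_nhds)).and self_mem_nhdsWithin).exists
  have h5 : ∀ z ∈ closedBall p ρ, DifferentiableAt ℂ f z := fun z hz => by
    rcases eq_or_ne z p with rfl | hzp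
    · exact hf.differentiableAt
    · exact h2 z hz hzp
  rw [← h3]
  exact Complex.circleIntegral_eq_zero_of_differentiable_on_off_countable (le_of_lt h4)
    countable_empty (fun z hz => (h5 z hz).continuousAt.continuousWithinAt)
    fun z hz => h5 z (ball_subset_closedBall hz.1)

lemma circleRes_sub {f g : ℂ → ℂ} {p : ℂ} (hf : ∀ᶠ z in 𝓝[≠] p, DifferentiableAt ℂ f z)
    (hg : ∀ᶠ z in 𝓝[≠] p, DifferentiableAt ℂ g z) :
    circleRes (fun z => f z - g z) p = circleRes f p - circleRes g p := by
  have hfg : ∀ᶠ z in 𝓝[≠] p, DifferentiableAt ℂ (fun z => f z - g z) z := by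
    filter_upwards [hf, hg] with z h1 h2 using h1.sub h2
  obtain ⟨ρ, ⟨⟨⟨h1, h2⟩, ⟨h3, h4⟩⟩, ⟨h5, h6⟩⟩, h7⟩ :=
    (((eventually_circleIntegral_eq_circleRes hf).and
      (eventually_circleIntegral_eq_circleRes hg)).and
      (eventually_circleIntegral_eq_circleRes hfg)).and self_mem_nhdsWithin |>.exists
  have h7 : 0 < ρ := h7
  rw [← h2, ← h4, ← h6]
  have key : ∀ z ∈ sphere p ρ, z ∈ closedBall p ρ ∧ z ≠ p := fun z hz =>
    ⟨sphere_subset_closedBall hz, fun h => by simp [h] at hz; exact h7.ne hz⟩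
  apply circleIntegral.integral_sub
  · exact ContinuousOn.circleIntegrable h7.le fun z hz =>
      (h1 z (key z hz).1 (key z hz).2).continuousAt.continuousWithinAt
  · exact ContinuousOn.circleIntegrable h7.le fun z hz =>
      (h3 z (key z hz).1 (key z hz).2).continuousAt.continuousWithinAt

lemma circleRes_congr {f g : ℂ → ℂ} {p : ℂ} (h : ∀ᶠ z in 𝓝[≠] p, f z = g z) :
    circleRes f p = circleRes g p := by
  unfold circleRes limUnder
  congr 1
  refine Filter.map_congr ?_
  rw [eventually_nhdsWithin_iff, Metric.eventually_nhds_iff] at h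
  obtain ⟨δ, hδ, h⟩ := h
  filter_upwards [Ioo_mem_nhdsGT hδ] with ρ hρ
  refine circleIntegral.integral_congr hρ.1.le fun z hz => h (lt_of_le_of_lt (le_of_eq hz) hρ.2) ?_
  rintro rfl
  simp at hz
  exact hρ.1.ne hz

/-- The substitution `t ↦ t/a`, which carries circles to circles. -/
lemma circleIntegral_dilation {a : ℝ} (ha : 0 < a) (f : ℂ → ℂ) (p : ℂ) (ρ : ℝ) :
    (∮ t in C(p, ρ), (a : ℂ)⁻¹ * f (t / a)) = ∮ t in C(p / a, ρ / a), f t := by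
  have ha' : (a : ℂ) ≠ 0 := by exact_mod_cast ha.ne'
  unfold circleIntegral
  congr 1
  ext θ
  simp only [deriv_circleMap, smul_eq_mul, circleMap]
  have : (p + ρ * Complex.exp (θ * Complex.I)) / (a : ℂ) =
      p / a + (ρ / a : ℝ) * Complex.exp (θ * Complex.I) := by
    push_cast; ring
  rw [this]
  push_cast
  field_simp
  ring

lemma circleRes_dilation {a : ℝ} (ha : 0 < a) {f : ℂ → ℂ} {p : ℂ}
    (hf : ∀ᶠ z in 𝓝[≠] (p / a), DifferentiableAt ℂ f z) :
    circleRes (fun t => (a : ℂ)⁻¹ * f (t / a)) p = circleRes f (p / a) := by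
  refine Tendsto.limUnder_eq (tendsto_const_nhds.congr' ?_)
  have h := eventually_circleIntegral_eq_circleRes hf
  have ht : Tendsto (fun ρ : ℝ => ρ / a) (𝓝[>] 0) (𝓝[>] 0) := by
    refine tendsto_nhdsWithin_iff.mpr ⟨?_, ?_⟩
    · have : Tendsto (fun ρ : ℝ => ρ / a) (𝓝 0) (𝓝 (0 / a)) :=
        (continuous_id.div_const a).tendsto 0
      rw [zero_div] at this
      exact this.mono_left nhdsWithin_le_nhds
    · filter_upwards [self_mem_nhdsWithin] with ρ hρ
      exact div_pos hρ ha
  filter_upwards [ht.eventually h] with ρ hρ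
  rw [circleIntegral_dilation ha, hρ.2]

lemma analyticAt_dslope {g : ℂ → ℂ} {s : ℂ} (hg : AnalyticAt ℂ g s) :
    AnalyticAt ℂ (dslope g s) s := by
  obtain ⟨p, hp⟩ := hg
  exact ⟨_, hp.has_fpower_series_dslope_fslope⟩

lemma analyticAt_mul_sub_zpow (c s : ℂ) (n : ℤ) {z : ℂ} (hz : z ≠ s) :
    AnalyticAt ℂ (fun z => c * (z - s) ^ n) z :=
  analyticAt_const.mul ((analyticAt_id.sub analyticAt_const).zpow (sub_ne_zero.mpr hz))

/-- The residue theorem in an annulus for a single polar term. -/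
lemma circleIntegral_sub_eq_circleRes_zpow {r R : ℝ} (hr : 0 < r) {s : ℂ} (h1 : r < ‖s‖)
    (h2 : ‖s‖ < R) (c : ℂ) (n : ℤ) :
    ((∮ z in C(0, R), c * (z - s) ^ n) - ∮ z in C(0, r), c * (z - s) ^ n) =
      circleRes (fun z => c * (z - s) ^ n) s := by
  have hr0 : (∮ z in C(0, r), c * (z - s) ^ n) = 0 := by
    refine Complex.circleIntegral_eq_zero_of_differentiable_on_off_countable hr.le
      countable_empty (fun z hz => ?_) fun z hz => ?_
    · refine (analyticAt_mul_sub_zpow c s n ?_).continuousAt.continuousWithinAt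
      rintro rfl
      exact (mem_closedBall_zero_iff.mp hz).not_gt h1
    · refine (analyticAt_mul_sub_zpow c s n ?_).differentiableAt
      rintro rfl
      exact (mem_ball_zero_iff.mp hz.1).not_gt h1
  rw [hr0, sub_zero, ← circleIntegral_eq_circleRes one_pos
    fun z _ hz => (analyticAt_mul_sub_zpow c s n hz).differentiableAt]
  simp only [circleIntegral.integral_const_mul]
  rcases eq_or_ne n (-1) with rfl | hn
  · simp only [zpow_neg_one]
    rw [circleIntegral.integral_sub_inv_of_mem_ball (by simpa using h2),
      circleIntegral.integral_sub_inv_of_mem_ball (by simp)]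
  · rw [circleIntegral.integral_sub_zpow_of_ne hn, circleIntegral.integral_sub_zpow_of_ne hn]

/-- The residue theorem in an annulus centred at `0`, for a function with finitely many poles.
The induction strips the leading polar term at one pole at a time. -/
theorem circleIntegral_sub_eq_sum_circleRes {r R : ℝ} (hr : 0 < r) (hrR : r ≤ R) (S : Finset ℂ) :
    (∀ s ∈ S, r < ‖s‖ ∧ ‖s‖ < R) → ∀ f : ℂ → ℂ,
    (∀ z, r ≤ ‖z‖ → ‖z‖ ≤ R → z ∉ S → AnalyticAt ℂ f z) → (∀ s ∈ S, MeromorphicAt f s) →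
    ((∮ z in C(0, R), f z) - ∮ z in C(0, r), f z) = ∑ s ∈ S, circleRes f s := by
  have hR : 0 < R := hr.trans_le hrR
  induction S using Finset.induction_on with
  | empty =>
    intro _ f hf _
    simp only [Finset.notMem_empty, not_false_eq_true, forall_const] at hf
    rw [Finset.sum_empty, sub_eq_zero]
    refine Complex.circleIntegral_eq_of_differentiable_on_annulus_off_countable hr hrR
      countable_empty (fun z hz => ?_) fun z hz => ?_
    · exact (hf z (by simpa using hz.2) (by simpa using hz.1)).continuousAt.continuousWithinAt
    · have h1 : ‖z‖ < R := by simpa using hz.1.1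
      have h2 : r < ‖z‖ := by simpa using hz.1.2
      exact (hf z h2.le h1.le).differentiableAt
  | insert s S hsS ih =>
    intro hS
    have hs := hS s (Finset.mem_insert_self _ _)
    have hS' : ∀ s ∈ S, r < ‖s‖ ∧ ‖s‖ < R := fun t ht => hS t (Finset.mem_insert_of_mem ht)
    have hcirc : ∀ f : ℂ → ℂ,
        (∀ z, r ≤ ‖z‖ → ‖z‖ ≤ R → z ∉ insert s S → AnalyticAt ℂ f z) →
        CircleIntegrable f 0 R ∧ CircleIntegrable f 0 r := by
      intro f hf
      constructor
      · refine ContinuousOn.circleIntegrable hR.le fun z hz => ?_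
        have hz' : ‖z‖ = R := by simpa using hz
        refine (hf z (hz' ▸ hrR) hz'.le fun h => ?_).continuousAt.continuousWithinAt
        exact ((hS z h).2.trans_eq hz'.symm).false
      · refine ContinuousOn.circleIntegrable hr.le fun z hz => ?_
        have hz' : ‖z‖ = r := by simpa using hz
        refine (hf z hz'.ge (hz' ▸ hrR) fun h => ?_).continuousAt.continuousWithinAt
        exact ((hS z h).1.trans_eq hz').false
    have key : ∀ (m : ℕ) (g f : ℂ → ℂ), AnalyticAt ℂ g s →
        (∀ᶠ z in 𝓝[≠] s, f z = (z - s) ^ (-(m : ℤ)) * g z) →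
        (∀ z, r ≤ ‖z‖ → ‖z‖ ≤ R → z ∉ insert s S → AnalyticAt ℂ f z) →
        (∀ t ∈ S, MeromorphicAt f t) →
        ((∮ z in C(0, R), f z) - ∮ z in C(0, r), f z) =
          ∑ s ∈ insert s S, circleRes f s := by
      intro m
      induction m with
      | zero =>
        intro g f hg hfg hf hm
        classical
        have hne : ∀ z, z ≠ s → Function.update f s (g s) =ᶠ[𝓝 z] f := fun z hz => by
          filter_upwards [isOpen_ne.mem_nhds hz] with w hw
          simp [Function.update_of_ne hw]
        have hs' : Function.update f s (g s) =ᶠ[𝓝 s] g := by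
          rw [eventually_nhdsWithin_iff] at hfg
          filter_upwards [hfg] with z hz
          rcases eq_or_ne z s with rfl | hzs
          · simp
          · simpa [Function.update_of_ne hzs] using hz hzs
        have h := ih hS' (Function.update f s (g s)) (fun z h1 h2 h3 => by
            rcases eq_or_ne z s with rfl | hzs
            · exact hg.congr hs'.symm
            · exact (hf z h1 h2 (by simp [hzs, h3])).congr (hne z hzs).symm)
          fun t ht => (hm t ht).congr
            ((hne t (by rintro rfl; exact hsS ht)).symm.filter_mono nhdsWithin_le_nhds)
        have hc : ∀ ρ, 0 ≤ ρ → ‖s‖ ≠ ρ →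
            (∮ z in C(0, ρ), Function.update f s (g s) z) = ∮ z in C(0, ρ), f z := by
          intro ρ hρ h1
          refine circleIntegral.integral_congr hρ fun z hz => ?_
          refine Function.update_of_ne ?_ _ _
          rintro rfl
          exact h1 (by simpa using hz)
        rw [hc R hR.le hs.2.ne, hc r hr.le hs.1.ne'] at h
        rw [h, Finset.sum_insert hsS]
        have h0 : circleRes f s = 0 := by
          rw [circleRes_congr (g := g) (by simpa using hfg)]
          exact circleRes_eq_zero hg
        rw [h0, zero_add]
        refine Finset.sum_congr rfl fun t ht => circleRes_congr ?_
        exact (hne t (by rintro rfl; exact hsS ht)).filter_mono nhdsWithin_le_nhds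
      | succ m ihm =>
        intro g f hg hfg hf hm
        set P : ℂ → ℂ := fun z => g s * (z - s) ^ (-((m + 1 : ℕ) : ℤ)) with hP
        have hPan : ∀ z, z ≠ s → AnalyticAt ℂ P z := fun z hz => analyticAt_mul_sub_zpow _ _ _ hz
        have hPan' : ∀ z, z ∉ insert s S → AnalyticAt ℂ P z := fun z hz => hPan z (by
          rintro rfl; simp at hz)
        have h := ihm (dslope g s) (fun z => f z - P z) (analyticAt_dslope hg) (by
            filter_upwards [hfg, self_mem_nhdsWithin] with z hz hzs
            have hzs' : z - s ≠ 0 := sub_ne_zero.mpr hzs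
            rw [hz, hP, dslope_of_ne _ hzs, slope_def_field]
            simp only [zpow_neg, zpow_natCast, pow_succ]
            field_simp)
          (fun z h1 h2 h3 => (hf z h1 h2 h3).sub (hPan' z h3))
          (fun t ht => (hm t ht).sub (hPan t (by rintro rfl; exact hsS ht)).meromorphicAt)
        obtain ⟨i1, i2⟩ := hcirc f hf
        obtain ⟨j1, j2⟩ := hcirc P fun z _ _ h => hPan' z h
        rw [circleIntegral.integral_sub i1 j1, circleIntegral.integral_sub i2 j2] at h
        have hPR := circleIntegral_sub_eq_circleRes_zpow hr hs.1 hs.2 (g s) (-((m + 1 : ℕ) : ℤ))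
        have hPS : ∑ t ∈ insert s S, circleRes P t = circleRes P s := by
          rw [Finset.sum_insert hsS, Finset.sum_eq_zero, add_zero]
          exact fun t ht => circleRes_eq_zero (hPan t (by rintro rfl; exact hsS ht))
        have hsub : ∀ t ∈ insert s S, circleRes (fun z => f z - P z) t =
            circleRes f t - circleRes P t := by
          intro t ht
          have hft : MeromorphicAt f t := by
            rcases Finset.mem_insert.mp ht with rfl | ht
            · exact (((MeromorphicAt.id _).sub (.const t t)).zpow _ |>.mul hg.meromorphicAt).congr
                (hfg.mono fun z hz => hz.symm)
            · exact hm t ht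
          have hPt : MeromorphicAt P t :=
            (MeromorphicAt.const _ _).mul (((MeromorphicAt.id _).sub (.const s t)).zpow _)
          exact circleRes_sub (hft.eventually_analyticAt.mono fun z hz => hz.differentiableAt)
            (hPt.eventually_analyticAt.mono fun z hz => hz.differentiableAt)
        rw [Finset.sum_congr rfl hsub, Finset.sum_sub_distrib, hPS] at h
        linear_combination h + hPR
    intro f hf hm
    obtain ⟨n, hn⟩ := hm s (Finset.mem_insert_self _ _)
    refine key n _ f hn ?_ hf fun t ht => hm t (Finset.mem_insert_of_mem ht)
    filter_upwards [self_mem_nhdsWithin] with z hz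
    have hzs' : z - s ≠ 0 := sub_ne_zero.mpr hz
    simp only [zpow_neg, zpow_natCast, smul_eq_mul]
    field_simp

/-! ### The residue form of the cycle integral -/

/-- The poles `x q^k` of the Askey-Wilson weight that the cycle has to encircle. -/
def innerPoles (prm : Fin 4 → ℂ) (q : ℝ) : Set ℂ :=
  {p | ∃ (i : Fin 4) (k : ℕ), p = prm i * (q : ℂ) ^ k}

lemma mem_outerPoles_iff {prm : Fin 4 → ℂ} {q : ℝ} {p : ℂ} :
    p ∈ outerPoles prm q ↔ p ∈ innerPoles prm q ∧ 1 < ‖p‖ := by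
  constructor
  · rintro ⟨i, k, rfl, h⟩
    exact ⟨⟨i, k, rfl⟩, h⟩
  · rintro ⟨⟨i, k, rfl⟩, h⟩
    exact ⟨i, k, rfl, h⟩

lemma mem_denominatorZeros_iff {prm : Fin 4 → ℂ} {q : ℝ} {p : ℂ} :
    p ∈ denominatorZeros prm q ↔ p ∈ innerPoles prm q ∨ p⁻¹ ∈ innerPoles prm q := by
  constructor
  · rintro ⟨i, k, h | h⟩
    · exact Or.inl ⟨i, k, h⟩
    · exact Or.inr ⟨i, k, by rw [h, inv_inv]⟩
  · rintro (⟨i, k, h⟩ | ⟨i, k, h⟩)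
    · exact ⟨i, k, Or.inl h⟩
    · exact ⟨i, k, Or.inr (by rw [← h, inv_inv])⟩

lemma mul_mem_innerPoles {prm : Fin 4 → ℂ} {q : ℝ} {p : ℂ} (h : p ∈ innerPoles prm q) :
    p * q ∈ innerPoles prm q := by
  obtain ⟨i, k, rfl⟩ := h
  exact ⟨i, k + 1, by ring⟩

lemma GenericParams.norm_ne_one {prm : Fin 4 → ℂ} {q : ℝ} (hg : GenericParams prm q) {p : ℂ}
    (hp : p ∈ innerPoles prm q) : ‖p‖ ≠ 1 := by
  obtain ⟨i, k, rfl⟩ := hp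
  exact hg.1 i k

lemma GenericParams.mul_mul_ne_one {prm : Fin 4 → ℂ} {q : ℝ} (hg : GenericParams prm q) {p p' : ℂ}
    (hp : p ∈ innerPoles prm q) (hp' : p' ∈ innerPoles prm q) (k : ℕ) :
    p * p' * (q : ℂ) ^ k ≠ 1 := by
  obtain ⟨i, m, rfl⟩ := hp
  obtain ⟨j, n, rfl⟩ := hp'
  intro h
  exact hg.2 i j (m + n + k) (by rw [← h]; ring)

lemma GenericParams.inv_notMem {prm : Fin 4 → ℂ} {q : ℝ} (hg : GenericParams prm q) {p : ℂ}
    (h0 : p ≠ 0) (hp : p ∈ innerPoles prm q) : p⁻¹ ∉ innerPoles prm q := fun h =>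
  hg.mul_mul_ne_one hp h 0 (by field_simp)

lemma finite_outerPoles {prm : Fin 4 → ℂ} {q : ℝ} (hq0 : 0 < q) (hq1 : q < 1) :
    (outerPoles prm q).Finite := by
  have h : ∀ i : Fin 4, {k : ℕ | 1 < ‖prm i * (q : ℂ) ^ k‖}.Finite := by
    intro i
    have ht : Tendsto (fun k : ℕ => ‖prm i * (q : ℂ) ^ k‖) atTop (𝓝 0) := by
      have := (tendsto_pow_atTop_nhds_zero_of_norm_lt_one
        (norm_ofReal_lt_one hq0 hq1)).const_mul (prm i)
      simpa using this.norm
    have h1 := ht.eventually (gt_mem_nhds one_pos)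
    rw [← Nat.cofinite_eq_atTop] at h1
    exact h1.subset fun k hk => not_lt.mpr (le_of_lt (show 1 < ‖prm i * (q : ℂ) ^ k‖ from hk))
  refine (finite_iUnion fun i => (h i).image fun k => prm i * (q : ℂ) ^ k).subset ?_
  rintro p ⟨i, k, rfl, hk⟩
  exact mem_iUnion.mpr ⟨i, k, hk, rfl⟩

/-- The integral over the cycle, with the integrals over the small circles written as residues;
in this form no radius enters. -/
def cycleRes (prm : Fin 4 → ℂ) (q : ℝ) (F : ℂ → ℂ) : ℂ :=
  (∮ t in C(0, 1), F t) + ∑ᶠ p ∈ outerPoles prm q, (circleRes F p - circleRes F p⁻¹)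

/-- On each small circle about a point of the cycle there are no zeros of the denominator. -/
lemma SmallRadius.notMem_denominatorZeros {prm : Fin 4 → ℂ} {q ε : ℝ} (hε : SmallRadius prm q ε)
    {p : ℂ} (hp : p ∈ outerPoles prm q) {c : ℂ} (hc : c = p ∨ c = p⁻¹) {z : ℂ}
    (hz : z ∈ closedBall c ε) (hzc : z ≠ c) : z ≠ 0 ∧ z ∉ denominatorZeros prm q := by
  obtain ⟨h1, h2⟩ := hε.2 p hp c hc
  exact ⟨by rintro rfl; exact h1 hz, fun h => hzc (h2 z h hz)⟩

lemma cycleIntegral_eq_cycleRes {prm : Fin 4 → ℂ} {q ε : ℝ} (hε : SmallRadius prm q ε)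
    {F : ℂ → ℂ} (hF : ∀ z, z ≠ 0 → z ∉ denominatorZeros prm q → DifferentiableAt ℂ F z) :
    cycleIntegral prm q ε F = cycleRes prm q F := by
  unfold cycleIntegral cycleRes
  congr 1
  refine finsum_congr fun p => finsum_congr fun hp => ?_
  congr 1
  · refine circleIntegral_eq_circleRes hε.1 fun z hz hzp => ?_
    obtain ⟨h1, h2⟩ := hε.notMem_denominatorZeros hp (Or.inl rfl) hz hzp
    exact hF z h1 h2
  · refine circleIntegral_eq_circleRes hε.1 fun z hz hzp => ?_
    obtain ⟨h1, h2⟩ := hε.notMem_denominatorZeros hp (Or.inr rfl) hz hzp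
    exact hF z h1 h2

lemma GenericParams.ne_zero_and_notMem_of_norm_eq_one {prm : Fin 4 → ℂ} {q : ℝ}
    (hg : GenericParams prm q) {z : ℂ} (hz : ‖z‖ = 1) :
    z ≠ 0 ∧ z ∉ denominatorZeros prm q := by
  refine ⟨by rintro rfl; simp at hz, fun h => ?_⟩
  rcases mem_denominatorZeros_iff.mp h with h | h
  · exact hg.norm_ne_one h hz
  · exact hg.norm_ne_one h (by simp [hz])

lemma cycleIntegral_congr {prm : Fin 4 → ℂ} {q ε : ℝ} (hg : GenericParams prm q)
    (hε : SmallRadius prm q ε) {F G : ℂ → ℂ}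
    (h : ∀ z, z ≠ 0 → z ∉ denominatorZeros prm q → F z = G z) :
    cycleIntegral prm q ε F = cycleIntegral prm q ε G := by
  have hsph : ∀ (c z : ℂ), z ∈ sphere c ε → z ∈ closedBall c ε ∧ z ≠ c := fun c z hz =>
    ⟨sphere_subset_closedBall hz, fun h => by simp [h] at hz; exact hε.1.ne hz⟩
  unfold cycleIntegral
  congr 1
  · refine circleIntegral.integral_congr zero_le_one fun z hz => ?_
    obtain ⟨h1, h2⟩ := hg.ne_zero_and_notMem_of_norm_eq_one (z := z) (by simpa using hz)
    exact h z h1 h2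
  · refine finsum_congr fun p => finsum_congr fun hp => ?_
    congr 1
    · refine circleIntegral.integral_congr hε.1.le fun z hz => ?_
      obtain ⟨h1, h2⟩ := hε.notMem_denominatorZeros hp (Or.inl rfl) (hsph _ _ hz).1 (hsph _ _ hz).2
      exact h z h1 h2
    · refine circleIntegral.integral_congr hε.1.le fun z hz => ?_
      obtain ⟨h1, h2⟩ := hε.notMem_denominatorZeros hp (Or.inr rfl) (hsph _ _ hz).1 (hsph _ _ hz).2
      exact h z h1 h2

lemma cycleIntegral_const_mul (prm : Fin 4 → ℂ) (q ε : ℝ) (c : ℂ) (F : ℂ → ℂ) :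
    cycleIntegral prm q ε (fun t => c * F t) = c * cycleIntegral prm q ε F := by
  unfold cycleIntegral
  simp only [circleIntegral.integral_const_mul, ← mul_sub, mul_add]
  congr 1
  simp only [← smul_eq_mul, smul_finsum]

lemma cycleIntegral_add {prm : Fin 4 → ℂ} {q ε : ℝ} (hq0 : 0 < q) (hq1 : q < 1)
    (hg : GenericParams prm q) (hε : SmallRadius prm q ε) {F G : ℂ → ℂ}
    (hF : ∀ z, z ≠ 0 → z ∉ denominatorZeros prm q → ContinuousAt F z)
    (hG : ∀ z, z ≠ 0 → z ∉ denominatorZeros prm q → ContinuousAt G z) :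
    cycleIntegral prm q ε (fun t => F t + G t) =
      cycleIntegral prm q ε F + cycleIntegral prm q ε G := by
  have hsph : ∀ (c z : ℂ), z ∈ sphere c ε → z ∈ closedBall c ε ∧ z ≠ c := fun c z hz =>
    ⟨sphere_subset_closedBall hz, fun h => by simp [h] at hz; exact hε.1.ne hz⟩
  have h0 : ∀ H : ℂ → ℂ, (∀ z, z ≠ 0 → z ∉ denominatorZeros prm q → ContinuousAt H z) →
      CircleIntegrable H 0 1 := fun H hH =>
    ContinuousOn.circleIntegrable zero_le_one fun z hz => by
      obtain ⟨h1, h2⟩ := hg.ne_zero_and_notMem_of_norm_eq_one (z := z) (by simpa using hz)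
      exact (hH z h1 h2).continuousWithinAt
  have hp : ∀ H : ℂ → ℂ, (∀ z, z ≠ 0 → z ∉ denominatorZeros prm q → ContinuousAt H z) →
      ∀ p ∈ outerPoles prm q, ∀ c, c = p ∨ c = p⁻¹ → CircleIntegrable H c ε :=
    fun H hH p hp c hc => ContinuousOn.circleIntegrable hε.1.le fun z hz => by
      obtain ⟨h1, h2⟩ := hε.notMem_denominatorZeros hp hc (hsph _ _ hz).1 (hsph _ _ hz).2
      exact (hH z h1 h2).continuousWithinAt
  unfold cycleIntegral
  rw [circleIntegral.integral_add (h0 F hF) (h0 G hG), add_add_add_comm,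
    ← finsum_mem_add_distrib (finite_outerPoles hq0 hq1)]
  congr 1
  refine finsum_congr fun p => finsum_congr fun h => ?_
  rw [circleIntegral.integral_add (hp F hF p h _ (Or.inl rfl)) (hp G hG p h _ (Or.inl rfl)),
    circleIntegral.integral_add (hp F hF p h _ (Or.inr rfl)) (hp G hG p h _ (Or.inr rfl))]
  ring

/-- Telescoping over the outer poles: as multiplication by `q` maps poles to poles, the sums of
`X(p)` and of `X(p/q)` differ by the terms with `1 < |p| < 1/q`. -/
lemma sum_outerPoles_sub_sum_div {prm : Fin 4 → ℂ} {q : ℝ} (hq0 : 0 < q) (hq1 : q < 1)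
    {O : Finset ℂ}
    (hO : ∀ p, p ∈ O ↔ p ∈ innerPoles prm q ∧ 1 < ‖p‖) (X : ℂ → ℂ)
    (hX : ∀ p ∈ O, p / q ∉ innerPoles prm q → X (p / q) = 0) :
    ∑ p ∈ O, X p - ∑ p ∈ O, X (p / q) = ∑ p ∈ O with ¬ 1 < ‖p * (q : ℂ)‖, X p := by
  classical
  have hq : (q : ℂ) ≠ 0 := by exact_mod_cast hq0.ne'
  have h1 : ∑ p ∈ O, X (p / q) = ∑ p ∈ O with 1 < ‖p * (q : ℂ)‖, X p := by
    rw [← Finset.sum_image (s := O) (g := fun p => p / (q : ℂ)) (f := X)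
      (fun a _ b _ hab => by simpa [div_left_inj' hq] using hab)]
    symm
    refine Finset.sum_subset ?_ ?_
    · intro p hp
      rw [Finset.mem_filter, hO] at hp
      exact Finset.mem_image.mpr
        ⟨p * q, (hO _).mpr ⟨mul_mem_innerPoles hp.1.1, hp.2⟩, by field_simp⟩
    · intro p' hp' hp2
      obtain ⟨p, hp, rfl⟩ := Finset.mem_image.mp hp'
      refine hX p hp fun hin => hp2 ?_
      have h1 := ((hO p).mp hp).2
      have hpq : p / q * q = p := by field_simp
      have hlt : 1 < ‖p / (q : ℂ)‖ := by
        rw [norm_div, Complex.norm_real, Real.norm_of_nonneg hq0.le, lt_div_iff₀ hq0]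
        linarith
      exact Finset.mem_filter.mpr ⟨(hO _).mpr ⟨hin, hlt⟩, by rwa [hpq]⟩
  rw [h1, ← Finset.sum_filter_add_sum_filter_not O (fun p => 1 < ‖p * (q : ℂ)‖) X]
  ring

/-- Moving the cycle by the dilation `t ↦ qt` does not change the integral of a form whose poles
are the inner poles `p` and the points `1/(qp)`: the residues picked up in the annulus
`1 < |t| < 1/q` compensate the changes in the sums over the outer poles. -/
theorem cycleRes_dilation {prm : Fin 4 → ℂ} {q : ℝ} (hq0 : 0 < q) (hq1 : q < 1)
    (hg : GenericParams prm q) {α : ℂ → ℂ}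
    (hα : ∀ z, z ≠ 0 → z ∉ innerPoles prm q → (q * z)⁻¹ ∉ innerPoles prm q → AnalyticAt ℂ α z)
    (hm : ∀ z, z ≠ 0 → MeromorphicAt α z) :
    cycleRes prm q (fun t => (q : ℂ)⁻¹ * α (t / q)) = cycleRes prm q α := by
  classical
  have hq : (q : ℂ) ≠ 0 := by exact_mod_cast hq0.ne'
  have hnq : ‖(q : ℂ)‖ = q := by rw [Complex.norm_real, Real.norm_of_nonneg hq0.le]
  have hd : ∀ z, z ≠ 0 → ∀ᶠ w in 𝓝[≠] z, DifferentiableAt ℂ α w := fun z hz =>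
    (hm z hz).eventually_analyticAt.mono fun w hw => hw.differentiableAt
  have hfin := finite_outerPoles (prm := prm) hq0 hq1
  set O := hfin.toFinset with hOdef
  have hO : ∀ p, p ∈ O ↔ p ∈ innerPoles prm q ∧ 1 < ‖p‖ := fun p => by
    rw [hOdef, hfin.mem_toFinset, mem_outerPoles_iff]
  have h0 : ∀ p ∈ O, p ≠ 0 := by
    rintro p hp rfl
    have := ((hO _).mp hp).2
    rw [norm_zero] at this
    linarith
  unfold cycleRes
  rw [finsum_mem_eq_finite_toFinset_sum _ hfin, finsum_mem_eq_finite_toFinset_sum _ hfin,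
    circleIntegral_dilation hq0, zero_div, Finset.sum_sub_distrib, Finset.sum_sub_distrib]
  have e1 : ∑ p ∈ O, circleRes (fun t => (q : ℂ)⁻¹ * α (t / q)) p =
      ∑ p ∈ O, circleRes α (p / q) := Finset.sum_congr rfl fun p hp =>
    circleRes_dilation hq0 (hd _ (div_ne_zero (h0 p hp) hq))
  have e2 : ∑ p ∈ O, circleRes (fun t => (q : ℂ)⁻¹ * α (t / q)) p⁻¹ =
      ∑ p ∈ O, circleRes α (p⁻¹ / q) := Finset.sum_congr rfl fun p hp =>
    circleRes_dilation hq0 (hd _ (div_ne_zero (inv_ne_zero (h0 p hp)) hq))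
  have s1 := sum_outerPoles_sub_sum_div hq0 hq1 hO (circleRes α) fun p hp hpq => by
    refine circleRes_eq_zero (hα _ (div_ne_zero (h0 p hp) hq) hpq ?_)
    rw [mul_div_cancel₀ _ hq]
    exact hg.inv_notMem (h0 p hp) ((hO p).mp hp).1
  have s2 := sum_outerPoles_sub_sum_div hq0 hq1 hO (fun p => circleRes α (p⁻¹ / q))
    fun p hp hpq => by
      have hpp : (p / q)⁻¹ / (q : ℂ) = p⁻¹ := by
        have := h0 p hp
        field_simp
      simp only [hpp]
      refine circleRes_eq_zero (hα _ (inv_ne_zero (h0 p hp))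
        (hg.inv_notMem (h0 p hp) ((hO p).mp hp).1) ?_)
      rwa [mul_inv, inv_inv, inv_mul_eq_div]
  have hs2 : ∑ p ∈ O, circleRes α ((p / q)⁻¹ / (q : ℂ)) = ∑ p ∈ O, circleRes α p⁻¹ :=
    Finset.sum_congr rfl fun p hp => by
      congr 1
      have := h0 p hp
      field_simp
  simp only [hs2] at s2
  set O1 := O.filter fun p => ¬ 1 < ‖p * (q : ℂ)‖ with hO1def
  have hO1 : ∀ p ∈ O1, p ∈ innerPoles prm q ∧ 1 < ‖p‖ ∧ ‖p‖ < 1 / q ∧ p ≠ 0 := by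
    intro p hp
    obtain ⟨h1, h2⟩ := Finset.mem_filter.mp hp
    have h3 := (hO p).mp h1
    refine ⟨h3.1, h3.2, ?_, h0 p h1⟩
    have h4 := lt_of_le_of_ne (not_lt.mp h2) (hg.norm_ne_one (mul_mem_innerPoles h3.1))
    rwa [norm_mul, hnq, ← lt_div_iff₀ hq0] at h4
  have hinj : Set.InjOn (fun p : ℂ => p⁻¹ / (q : ℂ)) O1 := fun a _ b _ hab => by
    simpa [div_left_inj' hq] using hab
  have hdisj : Disjoint O1 (O1.image fun p : ℂ => p⁻¹ / (q : ℂ)) := by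
    rw [Finset.disjoint_left]
    intro p hp hp'
    obtain ⟨p', hp', h⟩ := Finset.mem_image.mp hp'
    have h1 := hg.mul_mul_ne_one (hO1 p hp).1 (hO1 p' hp').1 1
    have h2 := (hO1 p' hp').2.2.2
    rw [← h] at h1
    exact h1 (by field_simp)
  have hann := circleIntegral_sub_eq_sum_circleRes one_pos (R := 1 / q)
    (by rw [le_div_iff₀ hq0]; linarith)
    (O1 ∪ O1.image fun p : ℂ => p⁻¹ / (q : ℂ))
    (by
      intro s hs
      rcases Finset.mem_union.mp hs with hs | hs
      · exact ⟨(hO1 s hs).2.1, (hO1 s hs).2.2.1⟩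
      · obtain ⟨p, hp, rfl⟩ := Finset.mem_image.mp hs
        obtain ⟨h1, h2, h3, h4⟩ := hO1 p hp
        have hp0 : 0 < ‖p‖ := by linarith
        rw [norm_div, norm_inv, hnq]
        rw [lt_div_iff₀ hq0] at h3
        constructor
        · rw [lt_div_iff₀ hq0, one_mul, lt_inv_comm₀ hq0 hp0, ← one_div, lt_div_iff₀ hq0]
          exact h3
        · exact div_lt_div_of_pos_right (inv_lt_one_of_one_lt₀ h2) hq0)
    α
    (by
      intro z h1 h2 hz
      have hz0 : z ≠ 0 := by
        rintro rfl
        rw [norm_zero] at h1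
        linarith
      rw [Finset.mem_union, not_or] at hz
      rw [le_div_iff₀ hq0] at h2
      refine hα z hz0 (fun hin => hz.1 ?_) (fun hin => hz.2 ?_)
      · refine Finset.mem_filter.mpr ⟨(hO z).mpr ⟨hin, lt_of_le_of_ne h1
          (hg.norm_ne_one hin).symm⟩, ?_⟩
        rw [norm_mul, hnq]
        exact h2.not_gt
      · refine Finset.mem_image.mpr ⟨(q * z)⁻¹, Finset.mem_filter.mpr ⟨(hO _).mpr ⟨hin,
          lt_of_le_of_ne ?_ (hg.norm_ne_one hin).symm⟩, ?_⟩, by field_simp⟩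
        · rw [norm_inv, norm_mul, hnq, mul_comm]
          exact (one_le_inv₀ (by positivity)).mpr h2
        · rw [norm_mul, norm_inv, norm_mul, hnq, not_lt, mul_inv, mul_right_comm,
            inv_mul_cancel₀ hq0.ne', one_mul]
          exact inv_le_one_of_one_le₀ h1)
    (by
      intro s hs
      refine hm s ?_
      rcases Finset.mem_union.mp hs with hs | hs
      · exact (hO1 s hs).2.2.2
      · obtain ⟨p, hp, rfl⟩ := Finset.mem_image.mp hs
        exact div_ne_zero (inv_ne_zero (hO1 p hp).2.2.2) hq)
  rw [Finset.sum_union hdisj, Finset.sum_image hinj] at hann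
  rw [e1, e2]
  linear_combination hann - s1 - s2

/-- Multiplying parameters by powers of `q` removes poles only, so that the cycle of the original
parameters may be replaced by that of the new ones. -/
lemma cycleRes_eq_of_subset {prm prm' : Fin 4 → ℂ} {q : ℝ} (hq0 : 0 < q) (hq1 : q < 1)
    (hg : GenericParams prm q) (hsub : innerPoles prm' q ⊆ innerPoles prm q) {F : ℂ → ℂ}
    (hF : ∀ z, z ≠ 0 → z ∉ denominatorZeros prm' q → AnalyticAt ℂ F z) :
    cycleRes prm q F = cycleRes prm' q F := by
  classical
  have hfin := finite_outerPoles (prm := prm) hq0 hq1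
  have hfin' := finite_outerPoles (prm := prm') hq0 hq1
  unfold cycleRes
  rw [finsum_mem_eq_finite_toFinset_sum _ hfin, finsum_mem_eq_finite_toFinset_sum _ hfin']
  congr 1
  symm
  refine Finset.sum_subset (fun p hp => ?_) fun p hp hp' => ?_
  · rw [Set.Finite.mem_toFinset, mem_outerPoles_iff] at *
    exact ⟨hsub hp.1, hp.2⟩
  · rw [Set.Finite.mem_toFinset, mem_outerPoles_iff] at *
    have h0 : p ≠ 0 := by
      rintro rfl
      have := hp.2
      rw [norm_zero] at this
      linarith
    have h1 : p ∉ innerPoles prm' q := fun h => hp' ⟨h, hp.2⟩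
    have h2 : p⁻¹ ∉ innerPoles prm' q := fun h => hg.inv_notMem h0 hp.1 (hsub h)
    rw [circleRes_eq_zero (hF p h0 ?_), circleRes_eq_zero (hF p⁻¹ (inv_ne_zero h0) ?_), sub_zero]
    · simp [mem_denominatorZeros_iff, h1, h2]
    · simp [mem_denominatorZeros_iff, h1, h2]

lemma eventually_notMem_innerPoles {q : ℝ} (hq0 : 0 < q) (hq1 : q < 1) (prm : Fin 4 → ℂ) {p : ℂ}
    (hp : p ≠ 0) : ∀ᶠ z in 𝓝[≠] p, z ∉ innerPoles prm q := by
  have hp0 : 0 < ‖p‖ := norm_pos_iff.mpr hp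
  -- After rescaling the parameters by `2/|p|`, the poles near `p` lie outside the unit circle.
  set S := outerPoles (fun i => prm i * (2 / ‖p‖ : ℝ)) q with hS
  have hSf : S.Finite := finite_outerPoles hq0 hq1
  have hT : ((fun z : ℂ => z * (‖p‖ / 2 : ℝ)) '' S \ {p}).Finite := (hSf.image _).sdiff
  have h1 : ∀ᶠ z in 𝓝 p, z ∉ (fun z : ℂ => z * (‖p‖ / 2 : ℝ)) '' S \ {p} :=
    hT.isClosed.isOpen_compl.mem_nhds (by simp)
  have h2 : ∀ᶠ z in 𝓝 p, ‖p‖ / 2 < ‖z‖ :=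
    continuous_norm.continuousAt.eventually (lt_mem_nhds (by linarith))
  filter_upwards [h1.filter_mono nhdsWithin_le_nhds, h2.filter_mono nhdsWithin_le_nhds,
    self_mem_nhdsWithin] with z hz1 hz2 hz3 hz
  refine hz1 ⟨⟨z * (2 / ‖p‖ : ℝ), ?_, ?_⟩, hz3⟩
  · rw [hS, mem_outerPoles_iff]
    constructor
    · obtain ⟨i, k, rfl⟩ := hz
      exact ⟨i, k, by ring⟩
    · rw [norm_mul, Complex.norm_real, Real.norm_of_nonneg (by positivity), mul_div_assoc',
        lt_div_iff₀ hp0]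
      linarith
  · have : (‖p‖ : ℂ) ≠ 0 := by exact_mod_cast hp0.ne'
    push_cast
    field_simp

lemma eventually_notMem_denominatorZeros {q : ℝ} (hq0 : 0 < q) (hq1 : q < 1) (prm : Fin 4 → ℂ)
    {p : ℂ} (hp : p ≠ 0) : ∀ᶠ z in 𝓝[≠] p, z ≠ 0 ∧ z ∉ denominatorZeros prm q := by
  have ht : Tendsto (fun z : ℂ => z⁻¹) (𝓝[≠] p) (𝓝[≠] p⁻¹) := by
    refine tendsto_nhdsWithin_iff.mpr
      ⟨(continuousAt_inv₀ hp).tendsto.mono_left nhdsWithin_le_nhds, ?_⟩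
    filter_upwards [self_mem_nhdsWithin] with z hz
    exact fun h => hz (inv_injective h)
  have h0 : ∀ᶠ z in 𝓝[≠] p, z ≠ 0 :=
    (isOpen_ne.eventually_mem hp).filter_mono nhdsWithin_le_nhds
  filter_upwards [eventually_notMem_innerPoles hq0 hq1 prm hp, h0,
    ht.eventually (eventually_notMem_innerPoles hq0 hq1 prm (inv_ne_zero hp))] with z h1 h2 h3
  refine ⟨h2, ?_⟩
  simp [mem_denominatorZeros_iff, h1, h3]

lemma exists_smallRadius {q : ℝ} (hq0 : 0 < q) (hq1 : q < 1) (prm : Fin 4 → ℂ) :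
    ∃ ε, SmallRadius prm q ε := by
  have key : ∀ c : ℂ, c ≠ 0 → ∀ᶠ ε in 𝓝[>] (0 : ℝ), (0 : ℂ) ∉ closedBall c ε ∧
      ∀ w ∈ denominatorZeros prm q, w ∈ closedBall c ε → w = c := by
    intro c hc
    have h := eventually_notMem_denominatorZeros hq0 hq1 prm hc
    rw [eventually_nhdsWithin_iff, Metric.eventually_nhds_iff] at h
    obtain ⟨δ, hδ, h⟩ := h
    filter_upwards [Ioo_mem_nhdsGT hδ] with ε hε
    constructor
    · intro h0
      exact (h (lt_of_le_of_lt h0 hε.2) hc.symm).1 rfl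
    · intro w hw hwc
      by_contra hne
      exact (h (lt_of_le_of_lt hwc hε.2) hne).2 hw
  have hall : ∀ᶠ ε in 𝓝[>] (0 : ℝ), ∀ p ∈ outerPoles prm q, ∀ c : ℂ, c = p ∨ c = p⁻¹ →
      (0 : ℂ) ∉ closedBall c ε ∧ ∀ w ∈ denominatorZeros prm q, w ∈ closedBall c ε → w = c := by
    rw [(finite_outerPoles hq0 hq1).eventually_all]
    intro p hp
    have hp0 : p ≠ 0 := by
      rintro rfl
      have := (mem_outerPoles_iff.mp hp).2
      rw [norm_zero] at this
      linarith
    filter_upwards [key p hp0, key p⁻¹ (inv_ne_zero hp0)] with ε h1 h2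
    rintro c (rfl | rfl)
    exacts [h1, h2]
  obtain ⟨ε, h1, h2⟩ := (hall.and self_mem_nhdsWithin).exists
  exact ⟨ε, h2, h1⟩

/-! ### The Askey-Wilson weight -/

/-- The Askey-Wilson weight `(t², t⁻²; q)_∞ / ∏_i (a_i t, a_i t⁻¹; q)_∞`. -/
def awWeight (prm : Fin 4 → ℂ) (q : ℝ) (t : ℂ) : ℂ :=
  qPochInf (t ^ 2) q * qPochInf ((t⁻¹) ^ 2) q /
    ∏ i, (qPochInf (prm i * t) q * qPochInf (prm i * t⁻¹) q)

lemma qPochInf_mul_ne_zero {q : ℝ} (hq0 : 0 < q) (hq1 : q < 1) {prm : Fin 4 → ℂ} {z : ℂ}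
    (hz : z⁻¹ ∉ innerPoles prm q) (i : Fin 4) : qPochInf (prm i * z) q ≠ 0 := by
  refine qPochInf_ne_zero hq0 hq1 fun k h => hz ⟨i, k, ?_⟩
  exact inv_eq_of_mul_eq_one_right (by rw [← h]; ring)

lemma qPochInf_mul_inv_ne_zero {q : ℝ} (hq0 : 0 < q) (hq1 : q < 1) {prm : Fin 4 → ℂ} {z : ℂ}
    (hz : z ∉ innerPoles prm q) (i : Fin 4) : qPochInf (prm i * z⁻¹) q ≠ 0 :=
  qPochInf_mul_ne_zero hq0 hq1 (by rwa [inv_inv]) i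

lemma analyticAt_inv_mul_awWeight {q : ℝ} (hq0 : 0 < q) (hq1 : q < 1) {prm : Fin 4 → ℂ} {z : ℂ}
    (hz0 : z ≠ 0) (hz : z ∉ denominatorZeros prm q) :
    AnalyticAt ℂ (fun t => t⁻¹ * awWeight prm q t) z := by
  rw [mem_denominatorZeros_iff, not_or] at hz
  have hi : AnalyticAt ℂ (fun t : ℂ => t⁻¹) z := analyticAt_inv hz0
  have hid : AnalyticAt ℂ (fun t : ℂ => t) z := analyticAt_id
  refine hi.mul (AnalyticAt.div ?_ ?_ ?_)
  · exact (analyticAt_qPochInf_comp hq0 hq1 (hid.pow 2)).mul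
      (analyticAt_qPochInf_comp hq0 hq1 (hi.pow 2))
  · exact Finset.analyticAt_fun_prod _ fun i _ =>
      (analyticAt_qPochInf_comp hq0 hq1 (analyticAt_const.mul hid)).mul
      (analyticAt_qPochInf_comp hq0 hq1 (analyticAt_const.mul hi))
  · exact Finset.prod_ne_zero_iff.mpr fun i _ =>
      mul_ne_zero (qPochInf_mul_ne_zero hq0 hq1 hz.2 i)
        (qPochInf_mul_inv_ne_zero hq0 hq1 hz.1 i)

/-- The function `A(t) = t⁻¹ (qt², t⁻²; q)_∞ / ∏_i (q a_i t, a_i t⁻¹; q)_∞`, for which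
`A(t) - A(t/q)` is the weight times a polynomial in `t + t⁻¹` of degree one. -/
def awPotential (prm : Fin 4 → ℂ) (q : ℝ) (t : ℂ) : ℂ :=
  t⁻¹ * (qPochInf (q * t ^ 2) q * qPochInf ((t⁻¹) ^ 2) q) /
    ∏ i, (qPochInf (prm i * (q * t)) q * qPochInf (prm i * t⁻¹) q)

lemma awPotential_analytic {q : ℝ} (hq0 : 0 < q) (hq1 : q < 1) {prm : Fin 4 → ℂ} {z : ℂ}
    (hz0 : z ≠ 0) :
    (z ∉ innerPoles prm q → (q * z)⁻¹ ∉ innerPoles prm q →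
      AnalyticAt ℂ (fun t => t⁻¹ * awPotential prm q t) z) ∧
    MeromorphicAt (fun t => t⁻¹ * awPotential prm q t) z := by
  have hi : AnalyticAt ℂ (fun t : ℂ => t⁻¹) z := analyticAt_inv hz0
  have hid : AnalyticAt ℂ (fun t : ℂ => t) z := analyticAt_id
  have h1 : AnalyticAt ℂ (fun t : ℂ => t⁻¹ * (qPochInf (q * t ^ 2) q * qPochInf ((t⁻¹) ^ 2) q)) z :=
    hi.mul ((analyticAt_qPochInf_comp hq0 hq1 (analyticAt_const.mul (hid.pow 2))).mul
      (analyticAt_qPochInf_comp hq0 hq1 (hi.pow 2)))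
  have h2 : AnalyticAt ℂ (fun t : ℂ =>
      ∏ i, (qPochInf (prm i * (q * t)) q * qPochInf (prm i * t⁻¹) q)) z :=
    Finset.analyticAt_fun_prod _ fun i _ =>
      (analyticAt_qPochInf_comp hq0 hq1 (analyticAt_const.mul (analyticAt_const.mul hid))).mul
      (analyticAt_qPochInf_comp hq0 hq1 (analyticAt_const.mul hi))
  refine ⟨fun hz1 hz2 => hi.mul (h1.div h2 ?_), hi.meromorphicAt.mul
    (h1.meromorphicAt.div h2.meromorphicAt)⟩
  exact Finset.prod_ne_zero_iff.mpr fun i _ =>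
    mul_ne_zero (qPochInf_mul_ne_zero hq0 hq1 hz2 i)
      (qPochInf_mul_inv_ne_zero hq0 hq1 hz1 i)

lemma awPotential_sub {q : ℝ} (hq0 : 0 < q) (hq1 : q < 1) {prm : Fin 4 → ℂ} {z : ℂ}
    (hz0 : z ≠ 0) (hz : z ∉ denominatorZeros prm q) :
    awPotential prm q z - awPotential prm q (z / q) = awWeight prm q z *
      ((1 - prm 0 * prm 1 * prm 2 * prm 3) * (z + z⁻¹) - (prm 0 + prm 1 + prm 2 + prm 3) +
        (prm 0 * prm 1 * prm 2 + prm 0 * prm 1 * prm 3 + prm 0 * prm 2 * prm 3 +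
          prm 1 * prm 2 * prm 3)) := by
  have hq : (q : ℂ) ≠ 0 := by exact_mod_cast hq0.ne'
  rw [mem_denominatorZeros_iff, not_or] at hz
  have d1 : ∀ i, qPochInf (prm i * z) q = (1 - prm i * z) * qPochInf (prm i * (q * z)) q := by
    intro i
    rw [qPochInf_eq_mul hq0 hq1]
    congr 2
    ring
  have d2 : ∀ i, qPochInf (prm i * z⁻¹) q = (1 - prm i * z⁻¹) * qPochInf (prm i * (z / q)⁻¹) q := by
    intro i
    rw [qPochInf_eq_mul hq0 hq1]
    congr 2
    field_simp
  have n1 : ∀ i, qPochInf (prm i * z) q ≠ 0 := qPochInf_mul_ne_zero hq0 hq1 hz.2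
  have n2 : ∀ i, qPochInf (prm i * z⁻¹) q ≠ 0 := qPochInf_mul_inv_ne_zero hq0 hq1 hz.1
  have n3 : ∀ i, 1 - prm i * z ≠ 0 ∧ qPochInf (prm i * (q * z)) q ≠ 0 := fun i => by
    have := n1 i
    rw [d1 i] at this
    exact ⟨left_ne_zero_of_mul this, right_ne_zero_of_mul this⟩
  have n4 : ∀ i, 1 - prm i * z⁻¹ ≠ 0 ∧ qPochInf (prm i * (z / q)⁻¹) q ≠ 0 := fun i => by
    have := n2 i
    rw [d2 i] at this
    exact ⟨left_ne_zero_of_mul this, right_ne_zero_of_mul this⟩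
  -- `U` is the weight without its factor `(1 - t²)(1 - t⁻²)`.
  set U := qPochInf (q * z ^ 2) q * qPochInf (q * (z⁻¹) ^ 2) q /
    ∏ i, (qPochInf (prm i * z) q * qPochInf (prm i * z⁻¹) q) with hU
  have e0 : qPochInf ((z⁻¹) ^ 2) q = (1 - (z⁻¹) ^ 2) * qPochInf (q * (z⁻¹) ^ 2) q := by
    rw [qPochInf_eq_mul hq0 hq1, mul_comm (q : ℂ)]
  have e1 : qPochInf (z ^ 2) q = (1 - z ^ 2) * qPochInf (q * z ^ 2) q := by
    rw [qPochInf_eq_mul hq0 hq1, mul_comm (q : ℂ)]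
  have hw : awWeight prm q z = U * ((1 - z ^ 2) * (1 - (z⁻¹) ^ 2)) := by
    rw [awWeight, e0, e1, hU]
    ring
  have hA : awPotential prm q z = U * (z⁻¹ * (1 - (z⁻¹) ^ 2) * ∏ i, (1 - prm i * z)) := by
    have hD : ∏ i, (qPochInf (prm i * z) q * qPochInf (prm i * z⁻¹) q) =
        (∏ i, (1 - prm i * z)) *
          ∏ i, (qPochInf (prm i * (q * z)) q * qPochInf (prm i * z⁻¹) q) := by
      rw [← Finset.prod_mul_distrib]
      exact Finset.prod_congr rfl fun i _ => by rw [d1 i, mul_assoc]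
    have h1 : ∏ i, (1 - prm i * z) ≠ 0 := Finset.prod_ne_zero_iff.mpr fun i _ => (n3 i).1
    rw [hU, hD, awPotential, e0]
    rw [div_mul_eq_mul_div, mul_comm (∏ i, (1 - prm i * z)), ← div_div, eq_div_iff h1,
      div_mul_eq_mul_div]
    congr 1
    ring
  have hB : awPotential prm q (z / q) = U * (-z * (1 - z ^ 2) * ∏ i, (1 - prm i * z⁻¹)) := by
    have hD : ∏ i, (qPochInf (prm i * z) q * qPochInf (prm i * z⁻¹) q) =
        (∏ i, (1 - prm i * z⁻¹)) *
          ∏ i, (qPochInf (prm i * z) q * qPochInf (prm i * (z / q)⁻¹) q) := by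
      rw [← Finset.prod_mul_distrib]
      exact Finset.prod_congr rfl fun i _ => by rw [d2 i]; ring
    have h1 : ∏ i, (1 - prm i * z⁻¹) ≠ 0 := Finset.prod_ne_zero_iff.mpr fun i _ => (n4 i).1
    have e2 : qPochInf (q * (z / q) ^ 2) q =
        (1 - z ^ 2 / q) * ((1 - z ^ 2) * qPochInf (q * z ^ 2) q) := by
      rw [← e1, qPochInf_eq_mul hq0 hq1]
      congr 2 <;> field_simp
    have e3 : qPochInf (q * (z⁻¹) ^ 2) q = (1 - q * (z⁻¹) ^ 2) * qPochInf (((z / q)⁻¹) ^ 2) q := by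
      rw [qPochInf_eq_mul hq0 hq1]
      congr 2
      field_simp
    rw [hU, hD, awPotential, e2, e3, mul_div_cancel₀ _ hq]
    rw [div_mul_eq_mul_div, mul_comm (∏ i, (1 - prm i * z⁻¹)), ← div_div, eq_div_iff h1,
      div_mul_eq_mul_div]
    congr 1
    field_simp
    ring
  rw [hw, hA, hB, ← mul_sub, mul_assoc U]
  congr 1
  simp only [Fin.prod_univ_four]
  field_simp
  ring

/-! ### Evaluation of the Askey-Wilson integral -/

lemma cycleRes_congr {q : ℝ} (hq0 : 0 < q) (hq1 : q < 1) {prm : Fin 4 → ℂ}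
    (hg : GenericParams prm q) {F G : ℂ → ℂ}
    (hG : ∀ z, z ≠ 0 → z ∉ denominatorZeros prm q → AnalyticAt ℂ G z)
    (hF : ∀ z, z ≠ 0 → z ∉ denominatorZeros prm q → AnalyticAt ℂ F z)
    (h : ∀ z, z ≠ 0 → z ∉ denominatorZeros prm q → F z = G z) :
    cycleRes prm q F = cycleRes prm q G := by
  obtain ⟨ε, hε⟩ := exists_smallRadius hq0 hq1 prm
  rw [← cycleIntegral_eq_cycleRes hε fun z h1 h2 => (hF z h1 h2).differentiableAt,
    ← cycleIntegral_eq_cycleRes hε fun z h1 h2 => (hG z h1 h2).differentiableAt,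
    cycleIntegral_congr hg hε h]

lemma cycleRes_lincomb {q : ℝ} (hq0 : 0 < q) (hq1 : q < 1) {prm : Fin 4 → ℂ}
    (hg : GenericParams prm q) {F G : ℂ → ℂ} (a b : ℂ)
    (hF : ∀ z, z ≠ 0 → z ∉ denominatorZeros prm q → AnalyticAt ℂ F z)
    (hG : ∀ z, z ≠ 0 → z ∉ denominatorZeros prm q → AnalyticAt ℂ G z) :
    cycleRes prm q (fun t => a * F t + b * G t) =
      a * cycleRes prm q F + b * cycleRes prm q G := by
  obtain ⟨ε, hε⟩ := exists_smallRadius hq0 hq1 prm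
  have hF' : ∀ z, z ≠ 0 → z ∉ denominatorZeros prm q → AnalyticAt ℂ (fun t => a * F t) z :=
    fun z h1 h2 => analyticAt_const.mul (hF z h1 h2)
  have hG' : ∀ z, z ≠ 0 → z ∉ denominatorZeros prm q → AnalyticAt ℂ (fun t => b * G t) z :=
    fun z h1 h2 => analyticAt_const.mul (hG z h1 h2)
  rw [← cycleIntegral_eq_cycleRes hε fun z h1 h2 => (hF z h1 h2).differentiableAt,
    ← cycleIntegral_eq_cycleRes hε fun z h1 h2 => (hG z h1 h2).differentiableAt,
    ← cycleIntegral_eq_cycleRes hε fun z h1 h2 =>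
      ((hF' z h1 h2).fun_add (hG' z h1 h2)).differentiableAt,
    cycleIntegral_add hq0 hq1 hg hε (fun z h1 h2 => (hF' z h1 h2).continuousAt)
      (fun z h1 h2 => (hG' z h1 h2).continuousAt), cycleIntegral_const_mul, cycleIntegral_const_mul]

/-- The weight times the degree-one Askey-Wilson polynomial, up to normalization, integrates to
zero, being a difference `A(t) - A(t/q)`. -/
lemma cycleRes_awWeight_linear {q : ℝ} (hq0 : 0 < q) (hq1 : q < 1) {prm : Fin 4 → ℂ}
    (hg : GenericParams prm q) :
    cycleRes prm q (fun t => t⁻¹ * awWeight prm q t *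
      ((1 - prm 0 * prm 1 * prm 2 * prm 3) * (t + t⁻¹) - (prm 0 + prm 1 + prm 2 + prm 3) +
        (prm 0 * prm 1 * prm 2 + prm 0 * prm 1 * prm 3 + prm 0 * prm 2 * prm 3 +
          prm 1 * prm 2 * prm 3))) = 0 := by
  have hq : (q : ℂ) ≠ 0 := by exact_mod_cast hq0.ne'
  set α : ℂ → ℂ := fun t => t⁻¹ * awPotential prm q t with hα
  have h1 : ∀ z, z ≠ 0 → z ∉ denominatorZeros prm q → AnalyticAt ℂ α z := fun z h0 hz => by
    rw [mem_denominatorZeros_iff, not_or] at hz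
    refine (awPotential_analytic hq0 hq1 h0).1 hz.1 fun h => hz.2 ?_
    convert mul_mem_innerPoles h using 1
    field_simp
  have h2 : ∀ z, z ≠ 0 → z ∉ denominatorZeros prm q →
      AnalyticAt ℂ (fun t => (q : ℂ)⁻¹ * α (t / q)) z := fun z h0 hz => by
    rw [mem_denominatorZeros_iff, not_or] at hz
    have h := (awPotential_analytic (prm := prm) hq0 hq1 (div_ne_zero h0 hq)).1
      (fun h => hz.1 (by convert mul_mem_innerPoles h using 1; field_simp))
      (by rw [mul_div_cancel₀ _ hq]; exact hz.2)
    exact analyticAt_const.mul (AnalyticAt.comp (g := α) (f := fun t : ℂ => t / q) h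
      (analyticAt_id.div analyticAt_const hq))
  have h3 := cycleRes_lincomb hq0 hq1 hg 1 (-1) h1 h2
  rw [cycleRes_dilation hq0 hq1 hg (fun z h0 => (awPotential_analytic hq0 hq1 h0).1)
    (fun z h0 => (awPotential_analytic hq0 hq1 h0).2)] at h3
  rw [cycleRes_congr hq0 hq1 hg (G := fun t => 1 * α t + -1 * ((q : ℂ)⁻¹ * α (t / q)))
    (fun z h0 hz => (analyticAt_const.mul (h1 z h0 hz)).fun_add (analyticAt_const.mul (h2 z h0 hz))) _ _, h3]
  · ring
  · intro z h0 hz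
    have hi : AnalyticAt ℂ (fun t : ℂ => t⁻¹) z := analyticAt_inv h0
    have hid : AnalyticAt ℂ (fun t : ℂ => t) z := analyticAt_id
    exact (analyticAt_inv_mul_awWeight hq0 hq1 h0 hz).mul
      (((analyticAt_const.mul (hid.add hi)).sub analyticAt_const).add analyticAt_const)
  · intro z h0 hz
    have := awPotential_sub hq0 hq1 h0 hz
    rw [mul_assoc, ← this]
    simp only [hα]
    field_simp
    ring

lemma innerPoles_update_subset (prm : Fin 4 → ℂ) (q : ℝ) (i : Fin 4) (n : ℕ) :
    innerPoles (Function.update prm i (prm i * (q : ℂ) ^ n)) q ⊆ innerPoles prm q := by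
  rintro p ⟨j, k, rfl⟩
  rcases eq_or_ne j i with rfl | hj
  · exact ⟨j, n + k, by simp; ring⟩
  · exact ⟨j, k, by simp [Function.update_of_ne hj]⟩

lemma GenericParams.of_subset {prm prm' : Fin 4 → ℂ} {q : ℝ} (hg : GenericParams prm q)
    (h : innerPoles prm' q ⊆ innerPoles prm q) : GenericParams prm' q := by
  refine ⟨fun i k => hg.norm_ne_one (h ⟨i, k, rfl⟩), fun i j k => ?_⟩
  have := hg.mul_mul_ne_one (h ⟨i, 0, rfl⟩) (h ⟨j, 0, rfl⟩) k
  simpa using this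

lemma denominatorZeros_subset {prm prm' : Fin 4 → ℂ} {q : ℝ}
    (h : innerPoles prm' q ⊆ innerPoles prm q) :
    denominatorZeros prm' q ⊆ denominatorZeros prm q := fun z hz => by
  rw [mem_denominatorZeros_iff] at *
  exact hz.imp (fun h' => h h') (fun h' => h h')

/-- Multiplying the parameter `a_i` by `q^n` multiplies the weight by `(a_i t, a_i t⁻¹; q)_n`. -/
lemma awWeight_update {q : ℝ} (hq0 : 0 < q) (hq1 : q < 1) {prm : Fin 4 → ℂ} (i : Fin 4) (n : ℕ)
    {z : ℂ} (hz : z ∉ denominatorZeros prm q) :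
    awWeight (Function.update prm i (prm i * (q : ℂ) ^ n)) q z =
      qPoch (prm i * z) q n * qPoch (prm i * z⁻¹) q n * awWeight prm q z := by
  rw [mem_denominatorZeros_iff, not_or] at hz
  have n1 := qPochInf_mul_ne_zero hq0 hq1 hz.2 i
  have n2 := qPochInf_mul_inv_ne_zero hq0 hq1 hz.1 i
  have e1 : qPochInf (prm i * z) q =
      qPoch (prm i * z) q n * qPochInf (prm i * (q : ℂ) ^ n * z) q := by
    rw [qPochInf_eq_qPoch_mul hq0 hq1 _ n, mul_right_comm]
  have e2 : qPochInf (prm i * z⁻¹) q =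
      qPoch (prm i * z⁻¹) q n * qPochInf (prm i * (q : ℂ) ^ n * z⁻¹) q := by
    rw [qPochInf_eq_qPoch_mul hq0 hq1 _ n, mul_right_comm]
  rw [e1] at n1
  rw [e2] at n2
  have m1 := left_ne_zero_of_mul n1
  have m2 := left_ne_zero_of_mul n2
  have hE : ∀ j ∈ Finset.univ.erase i, qPochInf (prm j * z) q * qPochInf (prm j * z⁻¹) q =
      qPochInf (Function.update prm i (prm i * (q : ℂ) ^ n) j * z) q *
        qPochInf (Function.update prm i (prm i * (q : ℂ) ^ n) j * z⁻¹) q := fun j hj => by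
    rw [Function.update_of_ne (Finset.ne_of_mem_erase hj)]
  have hD : ∏ j, (qPochInf (prm j * z) q * qPochInf (prm j * z⁻¹) q) =
      (qPoch (prm i * z) q n * qPoch (prm i * z⁻¹) q n) *
      ∏ j, (qPochInf (Function.update prm i (prm i * (q : ℂ) ^ n) j * z) q *
        qPochInf (Function.update prm i (prm i * (q : ℂ) ^ n) j * z⁻¹) q) := by
    rw [← Finset.mul_prod_erase _ _ (Finset.mem_univ i),
      ← Finset.mul_prod_erase (a := i) _ _ (Finset.mem_univ i), Function.update_self, e1, e2,
      Finset.prod_congr rfl hE]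
    ring
  rw [awWeight, awWeight, hD, mul_div_assoc', mul_div_mul_left _ _ (mul_ne_zero m1 m2)]

/-- The contiguity relation
`(1 - a₀a₁a₂a₃) I(a₀, …, q a_i, …, a₃) = ∏_{j ≠ i} (1 - a_i a_j) I(a₀, …, a₃)`: the polynomial
`(1 - a₀a₁a₂a₃) (1 - a_i t)(1 - a_i t⁻¹)` differs from the constant on the right by a multiple of
the linear polynomial with vanishing integral. -/
lemma cycleRes_awWeight_update {q : ℝ} (hq0 : 0 < q) (hq1 : q < 1) {prm : Fin 4 → ℂ}
    (hg : GenericParams prm q) (i : Fin 4) :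
    (1 - prm 0 * prm 1 * prm 2 * prm 3) *
      cycleRes (Function.update prm i (prm i * q)) q
        (fun t => t⁻¹ * awWeight (Function.update prm i (prm i * q)) q t) =
      (∏ j ∈ Finset.univ.erase i, (1 - prm i * prm j)) *
        cycleRes prm q (fun t => t⁻¹ * awWeight prm q t) := by
  have hsub := innerPoles_update_subset prm q i 1
  rw [pow_one] at hsub
  rw [← cycleRes_eq_of_subset hq0 hq1 hg hsub fun z h0 hz =>
    analyticAt_inv_mul_awWeight hq0 hq1 h0 hz]
  have hF : ∀ z, z ≠ 0 → z ∉ denominatorZeros prm q →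
      AnalyticAt ℂ (fun t => t⁻¹ * awWeight (Function.update prm i (prm i * q)) q t) z :=
    fun z h0 hz => analyticAt_inv_mul_awWeight hq0 hq1 h0
      fun h => hz (denominatorZeros_subset hsub h)
  have hG := fun z h0 hz => analyticAt_inv_mul_awWeight (prm := prm) (z := z) hq0 hq1 h0 hz
  have hL : ∀ z, z ≠ 0 → z ∉ denominatorZeros prm q → AnalyticAt ℂ
      (fun t => t⁻¹ * awWeight prm q t *
        ((1 - prm 0 * prm 1 * prm 2 * prm 3) * (t + t⁻¹) - (prm 0 + prm 1 + prm 2 + prm 3) +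
        (prm 0 * prm 1 * prm 2 + prm 0 * prm 1 * prm 3 + prm 0 * prm 2 * prm 3 +
          prm 1 * prm 2 * prm 3))) z := fun z h0 hz => by
    have hi : AnalyticAt ℂ (fun t : ℂ => t⁻¹) z := analyticAt_inv h0
    have hid : AnalyticAt ℂ (fun t : ℂ => t) z := analyticAt_id
    exact (hG z h0 hz).mul
      (((analyticAt_const.mul (hid.add hi)).sub analyticAt_const).add analyticAt_const)
  have l1 := cycleRes_lincomb hq0 hq1 hg (1 - prm 0 * prm 1 * prm 2 * prm 3) 0 hF hG
  have l2 := cycleRes_lincomb hq0 hq1 hg (∏ j ∈ Finset.univ.erase i, (1 - prm i * prm j))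
    (-prm i) hG hL
  rw [cycleRes_awWeight_linear hq0 hq1 hg] at l2
  rw [zero_mul, add_zero] at l1
  rw [mul_zero, add_zero] at l2
  rw [← l1, ← l2]
  refine cycleRes_congr hq0 hq1 hg (fun z h0 hz =>
    (analyticAt_const.mul (hG z h0 hz)).fun_add (analyticAt_const.mul (hL z h0 hz)))
    (fun z h0 hz => (analyticAt_const.mul (hF z h0 hz)).fun_add (analyticAt_const.mul (hG z h0 hz)))
    fun z h0 hz => ?_
  have hw := awWeight_update hq0 hq1 i 1 hz
  rw [pow_one] at hw
  rw [hw]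
  simp only [qPoch, Finset.prod_range_one, pow_zero, one_smul]
  have key : (1 - prm 0 * prm 1 * prm 2 * prm 3) * ((1 - prm i * z) * (1 - prm i * z⁻¹)) =
      (∏ j ∈ Finset.univ.erase i, (1 - prm i * prm j)) - prm i *
        ((1 - prm 0 * prm 1 * prm 2 * prm 3) * (z + z⁻¹) - (prm 0 + prm 1 + prm 2 + prm 3) +
        (prm 0 * prm 1 * prm 2 + prm 0 * prm 1 * prm 3 + prm 0 * prm 2 * prm 3 +
          prm 1 * prm 2 * prm 3)) := by
    have e0 : (Finset.univ.erase (0 : Fin 4)) = {1, 2, 3} := rfl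
    have e1 : (Finset.univ.erase (1 : Fin 4)) = {0, 2, 3} := rfl
    have e2 : (Finset.univ.erase (2 : Fin 4)) = {0, 1, 3} := rfl
    have e3 : (Finset.univ.erase (3 : Fin 4)) = {0, 1, 2} := rfl
    fin_cases i <;> simp [e0, e1, e2, e3] <;> field_simp <;> ring
  linear_combination z⁻¹ * awWeight prm q z * key

/-- The product `∏_{i<j} (a_i a_j; q)_∞` in the Askey-Wilson formula. -/
def pairProd (prm : Fin 4 → ℂ) (q : ℝ) : ℂ :=
  qPochInf (prm 0 * prm 1) q * qPochInf (prm 0 * prm 2) q * qPochInf (prm 0 * prm 3) q *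
    qPochInf (prm 1 * prm 2) q * qPochInf (prm 1 * prm 3) q * qPochInf (prm 2 * prm 3) q

/-- The Askey-Wilson integral divided by its expected dependence on the parameters. -/
def normalizedAW (prm : Fin 4 → ℂ) (q : ℝ) : ℂ :=
  cycleRes prm q (fun t => t⁻¹ * awWeight prm q t) * pairProd prm q /
    qPochInf (prm 0 * prm 1 * prm 2 * prm 3) q

lemma pairProd_eq_update {q : ℝ} (hq0 : 0 < q) (hq1 : q < 1) (prm : Fin 4 → ℂ) (i : Fin 4) :
    pairProd prm q = (∏ j ∈ Finset.univ.erase i, (1 - prm i * prm j)) *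
      pairProd (Function.update prm i (prm i * q)) q := by
  have e0 : (Finset.univ.erase (0 : Fin 4)) = {1, 2, 3} := rfl
  have e1 : (Finset.univ.erase (1 : Fin 4)) = {0, 2, 3} := rfl
  have e2 : (Finset.univ.erase (2 : Fin 4)) = {0, 1, 3} := rfl
  have e3 : (Finset.univ.erase (3 : Fin 4)) = {0, 1, 2} := rfl
  have h : ∀ a b : ℂ, qPochInf (a * b) q = (1 - a * b) * qPochInf (a * q * b) q := fun a b => by
    rw [qPochInf_eq_mul hq0 hq1, mul_right_comm]
  have h' : ∀ a b : ℂ, qPochInf (b * a) q = (1 - a * b) * qPochInf (b * (a * q)) q := fun a b => by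
    rw [qPochInf_eq_mul hq0 hq1, mul_assoc, mul_comm b a]
  fin_cases i
  · simp [e0, pairProd, Function.update]
    rw [h (prm 0) (prm 1), h (prm 0) (prm 2), h (prm 0) (prm 3)]; ring
  · simp [e1, pairProd, Function.update]
    rw [h' (prm 1) (prm 0), h (prm 1) (prm 2), h (prm 1) (prm 3)]; ring
  · simp [e2, pairProd, Function.update]
    rw [h' (prm 2) (prm 0), h' (prm 2) (prm 1), h (prm 2) (prm 3)]; ring
  · simp [e3, pairProd, Function.update]
    rw [h' (prm 3) (prm 0), h' (prm 3) (prm 1), h' (prm 3) (prm 2)]; ring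

lemma normalizedAW_update {q : ℝ} (hq0 : 0 < q) (hq1 : q < 1) {prm : Fin 4 → ℂ}
    (hg : GenericParams prm q) (h4 : ‖prm 0 * prm 1 * prm 2 * prm 3‖ < 1) (i : Fin 4) :
    normalizedAW (Function.update prm i (prm i * q)) q = normalizedAW prm q := by
  have h1 := cycleRes_awWeight_update hq0 hq1 hg i
  have h2 := pairProd_eq_update hq0 hq1 prm i
  have h3 := qPochInf_eq_mul hq0 hq1 (prm 0 * prm 1 * prm 2 * prm 3)
  have hne := qPochInf_ne_zero_of_norm_lt_one hq0 hq1 h4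
  have h5 : Function.update prm i (prm i * q) 0 * Function.update prm i (prm i * q) 1 *
      Function.update prm i (prm i * q) 2 * Function.update prm i (prm i * q) 3 =
      prm 0 * prm 1 * prm 2 * prm 3 * q := by
    fin_cases i <;> simp [Function.update] <;> ring
  rw [normalizedAW, normalizedAW, h5]
  rw [h3] at hne ⊢
  have n1 := left_ne_zero_of_mul hne
  have n2 := right_ne_zero_of_mul hne
  rw [h2, div_eq_div_iff n2 hne]
  linear_combination pairProd (Function.update prm i (prm i * q)) q *
    qPochInf (prm 0 * prm 1 * prm 2 * prm 3 * q) q * h1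

lemma norm_mul_ofReal_lt_one {q : ℝ} (hq0 : 0 < q) (hq1 : q < 1) {a : ℂ} (ha : ‖a‖ < 1) :
    ‖a * (q : ℂ)‖ < 1 := by
  rw [norm_mul]
  exact mul_lt_one_of_nonneg_of_lt_one_left (norm_nonneg _) ha (norm_ofReal_lt_one hq0 hq1).le

lemma normalizedAW_dilation {q : ℝ} (hq0 : 0 < q) (hq1 : q < 1) {prm : Fin 4 → ℂ}
    (hg : GenericParams prm q) (h4 : ‖prm 0 * prm 1 * prm 2 * prm 3‖ < 1) :
    normalizedAW (fun i => prm i * q) q = normalizedAW prm q := by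
  have step : ∀ (p : Fin 4 → ℂ) (i : Fin 4), GenericParams p q ∧ ‖p 0 * p 1 * p 2 * p 3‖ < 1 →
      (GenericParams (Function.update p i (p i * q)) q ∧
        ‖Function.update p i (p i * q) 0 * Function.update p i (p i * q) 1 *
          Function.update p i (p i * q) 2 * Function.update p i (p i * q) 3‖ < 1) ∧
      normalizedAW (Function.update p i (p i * q)) q = normalizedAW p q := by
    rintro p i ⟨h1, h2⟩
    refine ⟨⟨h1.of_subset (by simpa using innerPoles_update_subset p q i 1), ?_⟩,
      normalizedAW_update hq0 hq1 h1 h2 i⟩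
    have h5 : Function.update p i (p i * q) 0 * Function.update p i (p i * q) 1 *
        Function.update p i (p i * q) 2 * Function.update p i (p i * q) 3 =
        p 0 * p 1 * p 2 * p 3 * q := by
      fin_cases i <;> simp [Function.update] <;> ring
    rw [h5]
    exact norm_mul_ofReal_lt_one hq0 hq1 h2
  obtain ⟨s0, t0⟩ := step prm 0 ⟨hg, h4⟩
  obtain ⟨s1, t1⟩ := step _ 1 s0
  obtain ⟨s2, t2⟩ := step _ 2 s1
  obtain ⟨s3, t3⟩ := step _ 3 s2
  rw [← t0, ← t1, ← t2, ← t3]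
  congr 1
  ext i
  fin_cases i <;> simp [Function.update]

lemma innerPoles_mul_pow_subset (prm : Fin 4 → ℂ) (q : ℝ) (n : ℕ) :
    innerPoles (fun i => prm i * (q : ℂ) ^ n) q ⊆ innerPoles prm q := by
  rintro p ⟨i, k, rfl⟩
  exact ⟨i, n + k, by ring⟩

lemma normalizedAW_mul_pow {q : ℝ} (hq0 : 0 < q) (hq1 : q < 1) {prm : Fin 4 → ℂ}
    (hg : GenericParams prm q) (h4 : ‖prm 0 * prm 1 * prm 2 * prm 3‖ < 1) (n : ℕ) :
    normalizedAW (fun i => prm i * (q : ℂ) ^ n) q = normalizedAW prm q := by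
  induction n with
  | zero => simp
  | succ n ih =>
    rw [← ih, ← normalizedAW_dilation hq0 hq1 (hg.of_subset (innerPoles_mul_pow_subset prm q n))]
    · simp only [pow_succ, mul_assoc]
    · have : prm 0 * (q : ℂ) ^ n * (prm 1 * (q : ℂ) ^ n) * (prm 2 * (q : ℂ) ^ n) *
          (prm 3 * (q : ℂ) ^ n) = prm 0 * prm 1 * prm 2 * prm 3 * ((q : ℂ) ^ n) ^ 4 := by ring
      rw [this, norm_mul, norm_pow, norm_pow]
      exact mul_lt_one_of_nonneg_of_lt_one_left (norm_nonneg _) h4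
        (pow_le_one₀ (by positivity) (pow_le_one₀ (norm_nonneg _) (norm_ofReal_lt_one hq0 hq1).le))

lemma cycleRes_of_norm_lt_one {q : ℝ} (hq0 : 0 < q) (hq1 : q < 1) {prm : Fin 4 → ℂ}
    (h : ∀ i, ‖prm i‖ < 1) (F : ℂ → ℂ) : cycleRes prm q F = ∮ t in C(0, 1), F t := by
  have : outerPoles prm q = ∅ := by
    refine eq_empty_of_forall_notMem ?_
    rintro p ⟨i, k, -, hp⟩
    rw [norm_mul, norm_pow] at hp
    exact (mul_lt_one_of_nonneg_of_lt_one_left (norm_nonneg _) (h i)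
      (pow_le_one₀ (norm_nonneg _) (norm_ofReal_lt_one hq0 hq1).le)).not_gt hp
  simp [cycleRes, this]

lemma continuous_qPochInf {q : ℝ} (hq0 : 0 < q) (hq1 : q < 1) :
    Continuous fun a : ℂ => qPochInf a q :=
  (differentiable_qPochInf hq0 hq1).continuous

/-- On the unit circle the weight depends continuously on the parameters, up to the limit `0`. -/
lemma tendsto_circleIntegral_awWeight {q : ℝ} (hq0 : 0 < q) (hq1 : q < 1) {prm : Fin 4 → ℂ}
    (h : ∀ i, ‖prm i‖ < 1) :
    Tendsto (fun n : ℕ => ∮ t in C(0, 1), t⁻¹ * awWeight (fun i => prm i * (q : ℂ) ^ n) q t) atTop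
      (𝓝 (∮ t in C(0, 1), t⁻¹ * awWeight 0 q t)) := by
  have hc := continuous_qPochInf hq0 hq1
  have hcm : Continuous (circleMap 0 1) := continuous_circleMap 0 1
  have hne : ∀ θ, circleMap 0 1 θ ≠ 0 := fun θ => circleMap_ne_center one_ne_zero
  have hcmi : Continuous fun θ => (circleMap 0 1 θ)⁻¹ := hcm.inv₀ hne
  have hcont : Continuous (Function.uncurry fun (s : closedBall (0 : ℂ) 1) (θ : ℝ) =>
      deriv (circleMap 0 1) θ • ((circleMap 0 1 θ)⁻¹ *
        awWeight (fun i => prm i * (s : ℂ)) q (circleMap 0 1 θ))) := by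
    have h1 : Continuous fun x : closedBall (0 : ℂ) 1 × ℝ => circleMap 0 1 x.2 :=
      hcm.comp continuous_snd
    have h2 : Continuous fun x : closedBall (0 : ℂ) 1 × ℝ => (circleMap 0 1 x.2)⁻¹ :=
      hcmi.comp continuous_snd
    have h3 : Continuous fun x : closedBall (0 : ℂ) 1 × ℝ => (x.1 : ℂ) :=
      continuous_subtype_val.comp continuous_fst
    simp only [Function.uncurry_def, deriv_circleMap, awWeight]
    refine (h1.mul continuous_const).smul (h2.mul (Continuous.div ?_ ?_ ?_))
    · exact (hc.comp (h1.pow 2)).mul (hc.comp (h2.pow 2))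
    · exact continuous_finsetProd _ fun i _ =>
        (hc.comp ((continuous_const.mul h3).mul h1)).mul
          (hc.comp ((continuous_const.mul h3).mul h2))
    · rintro ⟨⟨s, hs⟩, θ⟩
      have hs' : ‖s‖ ≤ 1 := by simpa using hs
      have hps : ∀ i, ‖prm i * s‖ < 1 := fun i => by
        rw [norm_mul]
        exact mul_lt_one_of_nonneg_of_lt_one_left (norm_nonneg _) (h i) hs'
      exact Finset.prod_ne_zero_iff.mpr fun i _ => mul_ne_zero
        (qPochInf_ne_zero_of_norm_lt_one hq0 hq1 (by simpa using hps i))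
        (qPochInf_ne_zero_of_norm_lt_one hq0 hq1 (by simpa using hps i))
  have hI := intervalIntegral.continuous_parametric_intervalIntegral_of_continuous'
    (μ := MeasureTheory.volume) hcont 0 (2 * Real.pi)
  have hqn : ∀ n : ℕ, (q : ℂ) ^ n ∈ closedBall (0 : ℂ) 1 := fun n => by
    rw [mem_closedBall_zero_iff, norm_pow]
    exact pow_le_one₀ (norm_nonneg _) (norm_ofReal_lt_one hq0 hq1).le
  have ht : Tendsto (fun n : ℕ => (⟨(q : ℂ) ^ n, hqn n⟩ : closedBall (0 : ℂ) 1)) atTop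
      (𝓝 ⟨0, by simp⟩) := by
    rw [tendsto_subtype_rng]
    exact tendsto_pow_atTop_nhds_zero_of_norm_lt_one (norm_ofReal_lt_one hq0 hq1)
  have := (hI.tendsto ⟨0, by simp⟩).comp ht
  simp only [mul_zero] at this
  exact this

/-- The normalized integral does not depend on the parameters: it is invariant under their
multiplication by `q`, and tends to its value at the parameters `0`. -/
lemma normalizedAW_eq {q : ℝ} (hq0 : 0 < q) (hq1 : q < 1) {prm : Fin 4 → ℂ}
    (hg : GenericParams prm q) (h4 : ‖prm 0 * prm 1 * prm 2 * prm 3‖ < 1) :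
    normalizedAW prm q = ∮ t in C(0, 1), t⁻¹ * awWeight 0 q t := by
  have hpow := tendsto_pow_atTop_nhds_zero_of_norm_lt_one (norm_ofReal_lt_one hq0 hq1)
  have hpt : ∀ c, Tendsto (fun n : ℕ => c * (q : ℂ) ^ n) atTop (𝓝 0) := fun c => by
    simpa using hpow.const_mul c
  obtain ⟨N, hN⟩ : ∃ N : ℕ, ∀ i, ‖prm i * (q : ℂ) ^ N‖ < 1 := by
    have : ∀ᶠ n : ℕ in atTop, ∀ i, ‖prm i * (q : ℂ) ^ n‖ < 1 := by
      rw [eventually_all]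
      intro i
      have := (hpt (prm i)).norm
      rw [norm_zero] at this
      exact this.eventually (gt_mem_nhds one_pos)
    exact this.exists
  set b : Fin 4 → ℂ := fun i => prm i * (q : ℂ) ^ N with hb
  have hbn : ∀ n, normalizedAW (fun i => b i * (q : ℂ) ^ n) q = normalizedAW prm q := fun n => by
    rw [← normalizedAW_mul_pow hq0 hq1 hg h4 (N + n)]
    simp only [hb, pow_add, mul_assoc]
  have hcyc : ∀ n : ℕ, ∀ F, cycleRes (fun i => b i * (q : ℂ) ^ n) q F = ∮ t in C(0, 1), F t :=
    fun n F => cycleRes_of_norm_lt_one hq0 hq1 (fun i => by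
      rw [norm_mul, norm_pow]
      exact mul_lt_one_of_nonneg_of_lt_one_left (norm_nonneg _) (hN i)
        (pow_le_one₀ (norm_nonneg _) (norm_ofReal_lt_one hq0 hq1).le)) F
  have hP : ∀ f : ℕ → ℂ, Tendsto f atTop (𝓝 0) →
      Tendsto (fun n => qPochInf (f n) q) atTop (𝓝 1) := fun f hf => by
    have := ((continuous_qPochInf hq0 hq1).tendsto 0).comp hf
    rwa [qPochInf_zero] at this
  have h2 : ∀ i j, Tendsto (fun n : ℕ => b i * (q : ℂ) ^ n * (b j * (q : ℂ) ^ n)) atTop (𝓝 0) :=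
    fun i j => by simpa using (hpt (b i)).mul (hpt (b j))
  have hpair : Tendsto (fun n : ℕ => pairProd (fun i => b i * (q : ℂ) ^ n) q) atTop (𝓝 1) := by
    simpa [pairProd] using (((((hP _ (h2 0 1)).mul (hP _ (h2 0 2))).mul (hP _ (h2 0 3))).mul
      (hP _ (h2 1 2))).mul (hP _ (h2 1 3))).mul (hP _ (h2 2 3))
  have h4' : Tendsto (fun n : ℕ => b 0 * (q : ℂ) ^ n * (b 1 * (q : ℂ) ^ n) * (b 2 * (q : ℂ) ^ n) *
      (b 3 * (q : ℂ) ^ n)) atTop (𝓝 0) := by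
    simpa using ((h2 0 1).mul (hpt (b 2))).mul (hpt (b 3))
  have hlim : Tendsto (fun n : ℕ => normalizedAW (fun i => b i * (q : ℂ) ^ n) q) atTop
      (𝓝 ((∮ t in C(0, 1), t⁻¹ * awWeight 0 q t) * 1 / 1)) := by
    simp only [normalizedAW, hcyc]
    exact ((tendsto_circleIntegral_awWeight hq0 hq1 hN).mul hpair).div (hP _ h4') one_ne_zero
  simp only [hbn, mul_one, div_one] at hlim
  exact tendsto_nhds_unique tendsto_const_nhds hlim

/-- The constant in the Askey-Wilson formula, found from the parameters `q, -q, √q, -√q`, for which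
the weight reduces to `(1 - t²)(1 - t⁻²)`. -/
lemma circleIntegral_awWeight_zero {q : ℝ} (hq0 : 0 < q) (hq1 : q < 1) :
    (∮ t in C(0, 1), t⁻¹ * awWeight 0 q t) * qPochInf q q = 2 * (2 * Real.pi * Complex.I) := by
  obtain ⟨r, hr0, hr1, hr⟩ : ∃ r : ℝ, 0 < r ∧ r < 1 ∧ r ^ 2 = q :=
    ⟨√q, Real.sqrt_pos.mpr hq0, by rw [Real.sqrt_lt' one_pos]; simpa, Real.sq_sqrt hq0.le⟩
  have hrq : (r : ℂ) ^ 2 = q := by exact_mod_cast congrArg (fun x : ℝ => (x : ℂ)) hr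
  have hnq : ‖(q : ℂ)‖ = q := by rw [Complex.norm_real, Real.norm_of_nonneg hq0.le]
  have hnr : ‖(r : ℂ)‖ = r := by rw [Complex.norm_real, Real.norm_of_nonneg hr0.le]
  set prm : Fin 4 → ℂ := ![q, -q, r, -r] with hprm
  have hn : ∀ i, ‖prm i‖ < 1 := fun i => by
    fin_cases i <;> simp [hprm, abs_of_pos, hq0, hr0, hq1, hr1]
  have hg : GenericParams prm q := by
    constructor
    · intro i k
      rw [norm_mul, norm_pow]
      exact (mul_lt_one_of_nonneg_of_lt_one_left (norm_nonneg _) (hn i)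
        (pow_le_one₀ (norm_nonneg _) (norm_ofReal_lt_one hq0 hq1).le)).ne
    · intro i j k
      refine mul_pow_ne_one_of_norm_lt_one hq0 hq1 ?_ k
      rw [norm_mul]
      exact mul_lt_one_of_nonneg_of_lt_one_left (norm_nonneg _) (hn i) (hn j).le
  have p4 : prm 0 * prm 1 * prm 2 * prm 3 = (q : ℂ) ^ 3 := by
    simp [hprm]
    linear_combination (q : ℂ) ^ 2 * hrq
  have hn3 : ‖(q : ℂ) ^ 3‖ < 1 := by
    rw [norm_pow]
    exact pow_lt_one₀ (norm_nonneg _) (norm_ofReal_lt_one hq0 hq1) (by norm_num)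
  have hJ := normalizedAW_eq hq0 hq1 hg (by rw [p4]; exact hn3)
  -- `(z², …; q)_∞` as the product over the four values `z, -z, rz, -rz`.
  have hfac : ∀ z : ℂ, qPochInf (z ^ 2) q =
      (1 - z ^ 2) * (qPochInf (q * z) q * qPochInf (-q * z) q * qPochInf (r * z) q *
        qPochInf (-r * z) q) := by
    intro z
    have h1 := qPochInf_mul_neg hq0 hq1 z
    have h2 := qPochInf_mul_neg hq0 hq1 (r * z)
    have h3 := qPochInf_sq_mul hq0 hq1 (z ^ 2)
    rw [mul_pow, hrq] at h2
    rw [mul_comm (z ^ 2) (q : ℂ), ← h1, ← h2, qPochInf_eq_mul hq0 hq1 z,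
      qPochInf_eq_mul hq0 hq1 (-z)] at h3
    rw [← h3, mul_comm z, show -z * (q : ℂ) = -q * z by ring, neg_mul (r : ℂ)]
    ring
  have hw : ∀ z : ℂ, ‖z‖ = 1 → awWeight prm q z = (1 - z ^ 2) * (1 - (z⁻¹) ^ 2) := by
    intro z hz
    have hne : ∀ w : ℂ, ‖w‖ = 1 → ∀ i, qPochInf (prm i * w) q ≠ 0 := fun w hw i =>
      qPochInf_ne_zero_of_norm_lt_one hq0 hq1 (by rw [norm_mul, hw, mul_one]; exact hn i)
    have hz' : ‖z⁻¹‖ = 1 := by simp [hz]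
    have hD : ∏ i, (qPochInf (prm i * z) q * qPochInf (prm i * z⁻¹) q) ≠ 0 :=
      Finset.prod_ne_zero_iff.mpr fun i _ => mul_ne_zero (hne z hz i) (hne _ hz' i)
    rw [awWeight, div_eq_iff hD, hfac z, hfac z⁻¹, Fin.prod_univ_four]
    simp only [hprm, Matrix.cons_val]
    ring
  have hint : (∮ t in C(0, 1), t⁻¹ * awWeight prm q t) = 2 * (2 * Real.pi * Complex.I) := by
    have e : (∮ t in C(0, 1), t⁻¹ * awWeight prm q t) =
        ∮ t in C(0, 1), (2 * (t - 0) ^ (-1 : ℤ) - (t - 0) ^ (1 : ℤ)) - (t - 0) ^ (-3 : ℤ) := by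
      refine circleIntegral.integral_congr zero_le_one fun z hz => ?_
      have hz1 : ‖z‖ = 1 := by simpa using hz
      have hz0 : z ≠ 0 := by rintro rfl; simp at hz1
      simp only [hw z hz1, sub_zero]
      rw [zpow_neg_one, zpow_one, show (-3 : ℤ) = -((3 : ℕ) : ℤ) from rfl, zpow_neg, zpow_natCast]
      field_simp
      ring
    have hci : ∀ n : ℤ, CircleIntegrable (fun t : ℂ => (t - 0) ^ n) 0 1 := fun n =>
      circleIntegrable_sub_zpow_iff.mpr (by simp)
    have hci2 : CircleIntegrable (fun t : ℂ => 2 * (t - 0) ^ (-1 : ℤ)) 0 1 :=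
      (hci (-1)).const_smul (a := (2 : ℂ))
    have hci3 : CircleIntegrable (fun t : ℂ => 2 * (t - 0) ^ (-1 : ℤ) - (t - 0) ^ (1 : ℤ)) 0 1 :=
      hci2.sub (hci 1)
    rw [e, circleIntegral.integral_sub hci3 (hci (-3)),
      circleIntegral.integral_sub hci2 (hci 1), circleIntegral.integral_const_mul,
      circleIntegral.integral_sub_zpow_of_ne (n := 1) (by norm_num),
      circleIntegral.integral_sub_zpow_of_ne (n := -3) (by norm_num)]
    simp only [zpow_neg_one]
    rw [circleIntegral.integral_sub_center_inv _ one_ne_zero]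
    ring
  rw [normalizedAW, cycleRes_of_norm_lt_one hq0 hq1 hn, hint, p4] at hJ
  have hne3 := qPochInf_ne_zero_of_norm_lt_one hq0 hq1 hn3
  have hne1 := qPochInf_ne_zero_of_norm_lt_one hq0 hq1 (norm_ofReal_lt_one hq0 hq1)
  have g1 : (r : ℂ) * r = q := by rw [← hrq]; ring
  -- At `z = r` the factor `(q; q)_∞` cancels.
  have f1 : (1 - (q : ℂ)) * (qPochInf (q * r) q * qPochInf (-(q * r)) q) * qPochInf (-q) q = 1 := by
    have h := hfac r
    rw [hrq, g1, neg_mul, neg_mul, g1] at h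
    refine mul_right_cancel₀ hne1 ?_
    linear_combination -h
  have f2 : qPochInf (-q) q = (1 + (q : ℂ)) * qPochInf (-(q : ℂ) ^ 2) q := by
    rw [qPochInf_eq_mul hq0 hq1, sub_neg_eq_add]
    ring_nf
  have f3 : qPochInf q q = (1 - (q : ℂ)) * (1 - (q : ℂ) ^ 2) * qPochInf ((q : ℂ) ^ 3) q := by
    rw [qPochInf_eq_mul hq0 hq1, qPochInf_eq_mul hq0 hq1 ((q : ℂ) * q)]
    ring_nf
  have f4 : pairProd prm q = qPochInf (-(q : ℂ) ^ 2) q * qPochInf (-q) q *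
      (qPochInf (q * r) q * qPochInf (-(q * r)) q) ^ 2 := by
    have h1 : (q : ℂ) * -q = -(q : ℂ) ^ 2 := by ring
    simp only [pairProd, hprm, Matrix.cons_val, h1, mul_neg, neg_mul, g1, neg_neg]
    ring
  rw [← hJ, div_mul_eq_mul_div, div_eq_iff hne3, f3, f4]
  rw [f2] at f1 ⊢
  linear_combination 2 * (2 * Real.pi * Complex.I) * qPochInf ((q : ℂ) ^ 3) q *
    ((1 - (q : ℂ)) * (qPochInf (q * r) q * qPochInf (-(q * r)) q) *
      ((1 + (q : ℂ)) * qPochInf (-(q : ℂ) ^ 2) q) + 1) * f1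

/-- **The Askey-Wilson integral** over the cycle, for parameters in general position. -/
theorem cycleRes_awWeight {q : ℝ} (hq0 : 0 < q) (hq1 : q < 1) {prm : Fin 4 → ℂ}
    (hg : GenericParams prm q) (h4 : ‖prm 0 * prm 1 * prm 2 * prm 3‖ < 1) :
    cycleRes prm q (fun t => t⁻¹ * awWeight prm q t) * (qPochInf q q * pairProd prm q) =
      2 * (2 * Real.pi * Complex.I) * qPochInf (prm 0 * prm 1 * prm 2 * prm 3) q := by
  have h := normalizedAW_eq hq0 hq1 hg h4
  rw [normalizedAW, div_eq_iff (qPochInf_ne_zero_of_norm_lt_one hq0 hq1 h4)] at h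
  linear_combination qPochInf q q * h + qPochInf (prm 0 * prm 1 * prm 2 * prm 3) q *
    circleIntegral_awWeight_zero hq0 hq1

/-! ### Evaluation of Laurent polynomials -/

lemma evalL_add (f g : Laurent3) (z : Fin 3 → ℂ) : evalL (f + g) z = evalL f z + evalL g z := by
  unfold evalL
  rw [AddMonoidAlgebra.coeff_add]
  exact Finsupp.sum_add_index' (fun n => by simp) (fun n a b => by ring)

lemma evalL_smul (c : ℂ) (f : Laurent3) (z : Fin 3 → ℂ) : evalL (c • f) z = c * evalL f z := by
  unfold evalL
  rw [AddMonoidAlgebra.coeff_smul, Finsupp.sum_smul_index' (fun n => by simp), Finsupp.mul_sum]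
  simp only [smul_eq_mul, mul_assoc]

/-- Evaluation at a point with nonzero coordinates, as a homomorphism of algebras. -/
def evalHom (z : Fin 3 → ℂ) (hz : ∀ i, z i ≠ 0) : Laurent3 →ₐ[ℂ] ℂ :=
  AddMonoidAlgebra.lift ℂ ℂ (Fin 3 → ℤ)
    { toFun := fun n => ∏ i, z i ^ (Multiplicative.toAdd n) i
      map_one' := by simp
      map_mul' := fun m n => by
        simp [zpow_add₀ (hz _), Finset.prod_mul_distrib] }

lemma evalHom_apply (z : Fin 3 → ℂ) (hz : ∀ i, z i ≠ 0) (f : Laurent3) :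
    evalHom z hz f = evalL f z := by
  simp [evalHom, AddMonoidAlgebra.lift_apply, evalL]

lemma evalHom_mono (z : Fin 3 → ℂ) (hz : ∀ i, z i ≠ 0) (a b c : ℤ) :
    evalHom z hz (mono a b c) = z 0 ^ a * z 1 ^ b * z 2 ^ c := by
  simp [evalHom, mono, AddMonoidAlgebra.lift_single, Fin.prod_univ_three]

lemma map_qPoch {R S : Type*} [CommRing R] [Algebra ℂ R] [CommRing S] [Algebra ℂ S] (φ : R →ₐ[ℂ] S)
    (a : R) (q : ℝ) (n : ℕ) : φ (qPoch a q n) = qPoch (φ a) q n := by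
  simp [qPoch]

lemma evalL_pT (q g : ℝ) (j k : ℤ) (ν : ℕ) {z : Fin 3 → ℂ} (hz : ∀ i, z i ≠ 0) :
    evalL (pT q g j k ν) z = z 0 ^ k * z 1 ^ k * z 2 ^ (j - 2 * k) *
      (qPoch ((ell q g : ℂ)⁻¹ * (z 0 * (z 2)⁻¹)) q ν *
        qPoch ((ell q g : ℂ)⁻¹ * (z 1 * (z 2)⁻¹)) q ν) := by
  rw [← evalHom_apply z hz, pT]
  simp only [map_mul, map_qPoch, map_smul, evalHom_mono]
  simp

lemma evalL_pY (q : ℝ) (j k : ℤ) (ν : ℕ) {z : Fin 3 → ℂ} (hz : ∀ i, z i ≠ 0) :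
    evalL (pY q j k ν) z = z 0 ^ k * z 1 ^ k * z 2 ^ j *
      (qPoch (z 0) q ν * qPoch (z 1) q ν) := by
  rw [← evalHom_apply z hz, pY]
  simp only [map_mul, map_qPoch, evalHom_mono]
  simp

lemma continuousAt_evalL (f : Laurent3) (c x : ℂ) {t : ℂ} (ht : t ≠ 0) (hc : c ≠ 0) :
    ContinuousAt (fun t => evalL f ![c * t, c * t⁻¹, x]) t := by
  unfold evalL Finsupp.sum
  refine tendsto_finsetSum _ fun n _ => ?_
  simp only [Fin.prod_univ_three]
  have h1 : ContinuousAt (fun t => c * t) t := by fun_prop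
  have h2 : ContinuousAt (fun t => c * t⁻¹) t := continuousAt_const.mul (continuousAt_inv₀ ht)
  exact continuousAt_const.mul (((h1.zpow₀ _ (Or.inl (mul_ne_zero hc ht))).mul
    (h2.zpow₀ _ (Or.inl (mul_ne_zero hc (inv_ne_zero ht))))).mul continuousAt_const)

/-! ### The operator on the basis -/

/-- The constant factor of the kernel of `M`. -/
def kernelConst (q g : ℝ) (yp ym : ℂ) : ℂ :=
  ((1 - q : ℝ) : ℂ) * qPochInf (q : ℂ) q ^ 2 *
    Lq q ((ell q g ^ (-(3 / 2) : ℝ) : ℝ) : ℂ) ym (tPlus q g yp) / (2 * qBeta q g (2 * g))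

lemma ell_rpow {q : ℝ} (hq0 : 0 < q) (g s : ℝ) : ell q g ^ s = q ^ (-g * s) := by
  rw [ell, ← Real.rpow_mul hq0.le]

lemma ell_inv {q : ℝ} (hq0 : 0 < q) (g : ℝ) : (ell q g : ℂ)⁻¹ = ((q ^ g : ℝ) : ℂ) := by
  rw [ell, Real.rpow_neg hq0.le]
  push_cast
  rw [inv_inv]

lemma kernelM_eq {q : ℝ} (hq0 : 0 < q) (g : ℝ) (yp ym t : ℂ) :
    kernelM q g yp ym t = kernelConst q g yp ym * awWeight (paramsM q g yp ym) q t := by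
  unfold kernelM kernelConst awWeight paramsM cycleParams
  rw [div_mul_div_comm]
  congr 1
  · ring
  · rw [Fin.prod_univ_four, ell_inv hq0, ell_rpow hq0, Lq, Lq,
      show -g * -(1 / 2) = g / 2 by ring, show 2 * g / 2 = g by ring]
    simp only [Matrix.cons_val]
    ring_nf

lemma cast_rpow_mul {q : ℝ} (hq0 : 0 < q) (a b : ℝ) :
    ((q ^ a : ℝ) : ℂ) * ((q ^ b : ℝ) : ℂ) = ((q ^ (a + b) : ℝ) : ℂ) := by
  rw [Real.rpow_add hq0]
  push_cast
  rfl

lemma tPlus_ne_zero {q : ℝ} (hq0 : 0 < q) (g : ℝ) {yp : ℂ} (hyp : yp ≠ 0) :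
    tPlus q g yp ≠ 0 := by
  refine mul_ne_zero hyp ?_
  rw [ell_rpow hq0]
  exact_mod_cast (Real.rpow_pos_of_pos hq0 _).ne'

lemma paramsM_mul {q : ℝ} (hq0 : 0 < q) (g : ℝ) {yp ym : ℂ} (hyp : yp ≠ 0) (hym : ym ≠ 0) :
    paramsM q g yp ym 0 * paramsM q g yp ym 1 = ((q ^ g : ℝ) : ℂ) ∧
    paramsM q g yp ym 2 * paramsM q g yp ym 3 = ((q ^ (2 * g) : ℝ) : ℂ) ∧
    paramsM q g yp ym 0 * paramsM q g yp ym 2 = yp * ym ∧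
    paramsM q g yp ym 1 * paramsM q g yp ym 2 = yp / ym := by
  have hT := tPlus_ne_zero hq0 g hyp
  have h1 := cast_rpow_mul hq0 (g / 2) (g / 2)
  have h2 := cast_rpow_mul hq0 (2 * g / 2) (2 * g / 2)
  have h3 : ((q ^ (-g * (3 / 2)) : ℝ) : ℂ) * (((q ^ (g / 2) : ℝ) : ℂ) *
      ((q ^ (2 * g / 2) : ℝ) : ℂ)) = 1 := by
    rw [cast_rpow_mul hq0, cast_rpow_mul hq0, show -g * (3 / 2) + (g / 2 + 2 * g / 2) = 0 by ring,
      Real.rpow_zero, Complex.ofReal_one]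
  rw [add_halves] at h1 h2
  simp only [paramsM, cycleParams, Matrix.cons_val]
  refine ⟨?_, ?_, ?_, ?_⟩
  · rw [← h1]; field_simp
  · rw [← h2]; field_simp
  · rw [tPlus, ell_rpow hq0]
    linear_combination yp * ym * h3
  · rw [tPlus, ell_rpow hq0]
    linear_combination yp / ym * h3

lemma qBeta_eq {q : ℝ} (hq0 : 0 < q) (hq1 : q < 1) {g : ℝ} (hg : 0 < g) :
    qBeta q g (2 * g) * (qPochInf ((q ^ g : ℝ) : ℂ) q * qPochInf ((q ^ (2 * g) : ℝ) : ℂ) q) =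
      ((1 - q : ℝ) : ℂ) * qPochInf q q * qPochInf ((q ^ (3 * g) : ℝ) : ℂ) q := by
  have hn : ∀ s : ℝ, 0 < s → qPochInf ((q ^ s : ℝ) : ℂ) q ≠ 0 := fun s hs => by
    refine qPochInf_ne_zero_of_norm_lt_one hq0 hq1 ?_
    rw [Complex.norm_real, Real.norm_of_nonneg (Real.rpow_pos_of_pos hq0 _).le]
    exact Real.rpow_lt_one hq0.le hq1 hs
  have hq : qPochInf q q ≠ 0 :=
    qPochInf_ne_zero_of_norm_lt_one hq0 hq1 (norm_ofReal_lt_one hq0 hq1)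
  have h1q : 0 < 1 - q := by linarith
  have hp : ∀ s : ℝ, (((1 - q) ^ s : ℝ) : ℂ) ≠ 0 := fun s => by
    exact_mod_cast (Real.rpow_pos_of_pos h1q s).ne'
  have h3 : (((1 - q) ^ (3 * g - 1) : ℝ) : ℂ) =
      ((1 - q : ℝ) : ℂ) * (((1 - q) ^ (g - 1) : ℝ) : ℂ) * (((1 - q) ^ (2 * g - 1) : ℝ) : ℂ) := by
    have : (1 - q) ^ (3 * g - 1) = (1 - q) * (1 - q) ^ (g - 1) * (1 - q) ^ (2 * g - 1) := by
      rw [← Real.rpow_one_add' h1q.le (by linarith), ← Real.rpow_add h1q]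
      ring_nf
    exact_mod_cast this
  have n1 := hn g hg
  have n2 := hn (2 * g) (by linarith)
  have n3 := hn (3 * g) (by linarith)
  have p1 := hp (g - 1)
  have p2 := hp (2 * g - 1)
  have p0 : ((1 - q : ℝ) : ℂ) ≠ 0 := by exact_mod_cast h1q.ne'
  rw [qBeta, show g + 2 * g = 3 * g by ring, qGamma, qGamma, qGamma, h3]
  generalize qPochInf ((q ^ (2 * g) : ℝ) : ℂ) q = X at *
  generalize qPochInf ((q ^ (3 * g) : ℝ) : ℂ) q = Y at *
  generalize (((1 - q) ^ (2 * g - 1) : ℝ) : ℂ) = Z at *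
  field_simp

/-- The kernel of `M` is normalized by the Askey-Wilson formula. -/
lemma kernelConst_eq {q : ℝ} (hq0 : 0 < q) (hq1 : q < 1) {g : ℝ} (hg : 0 < g) {yp ym : ℂ}
    (hyp : yp ≠ 0) (hym : ym ≠ 0) :
    kernelConst q g yp ym * (2 * qPochInf ((q ^ (3 * g) : ℝ) : ℂ) q) =
      qPochInf q q * pairProd (paramsM q g yp ym) q := by
  have hn : ∀ s : ℝ, 0 < s → qPochInf ((q ^ s : ℝ) : ℂ) q ≠ 0 := fun s hs => by
    refine qPochInf_ne_zero_of_norm_lt_one hq0 hq1 ?_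
    rw [Complex.norm_real, Real.norm_of_nonneg (Real.rpow_pos_of_pos hq0 _).le]
    exact Real.rpow_lt_one hq0.le hq1 hs
  have hq : qPochInf q q ≠ 0 :=
    qPochInf_ne_zero_of_norm_lt_one hq0 hq1 (norm_ofReal_lt_one hq0 hq1)
  have p0 : ((1 - q : ℝ) : ℂ) ≠ 0 := by exact_mod_cast (by linarith : 1 - q ≠ 0)
  obtain ⟨e01, e23, -, -⟩ := paramsM_mul hq0 g hyp hym
  have hB := qBeta_eq hq0 hq1 hg
  have hB0 : qBeta q g (2 * g) ≠ 0 := by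
    intro h
    rw [h, zero_mul] at hB
    exact mul_ne_zero (mul_ne_zero p0 hq) (hn (3 * g) (by linarith)) hB.symm
  have hP : pairProd (paramsM q g yp ym) q = qPochInf ((q ^ g : ℝ) : ℂ) q *
      qPochInf ((q ^ (2 * g) : ℝ) : ℂ) q *
      Lq q ((ell q g ^ (-(3 / 2) : ℝ) : ℝ) : ℂ) ym (tPlus q g yp) := by
    have h : ((q ^ (-g * -(3 / 2)) : ℝ) : ℂ) =
        ((q ^ (g / 2) : ℝ) : ℂ) * ((q ^ (2 * g / 2) : ℝ) : ℂ) := by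
      rw [cast_rpow_mul hq0]
      ring_nf
    rw [pairProd, e01, e23, Lq, ell_rpow hq0, h]
    simp only [paramsM, cycleParams, Matrix.cons_val]
    ring_nf
  rw [kernelConst, hP]
  rw [div_mul_eq_mul_div, div_eq_iff (mul_ne_zero two_ne_zero hB0)]
  linear_combination -2 * qPochInf q q *
    Lq q ((ell q g ^ (-(3 / 2) : ℝ) : ℝ) : ℂ) ym (tPlus q g yp) * hB

lemma opM_eq {q g ε : ℝ} (hq0 : 0 < q) (Ψ : (Fin 3 → ℂ) → ℂ) (x yp ym : ℂ) :
    opM q g ε Ψ x yp ym = (2 * (Real.pi : ℂ) * Complex.I)⁻¹ * (kernelConst q g yp ym *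
      cycleIntegral (paramsM q g yp ym) q ε fun t =>
        t⁻¹ * awWeight (paramsM q g yp ym) q t *
          Ψ ![tPlus q g yp * x * t, tPlus q g yp * x * t⁻¹, x]) := by
  rw [opM, ← cycleIntegral_const_mul _ _ _ (kernelConst q g yp ym)]
  simp only [kernelM_eq hq0]
  congr 2
  funext t
  ring

/-- The operator is linear on Laurent polynomials. -/
lemma opM_add_smul {q g ε : ℝ} (hq0 : 0 < q) (hq1 : q < 1) {x yp ym : ℂ} (hx : x ≠ 0)
    (hyp : yp ≠ 0) (hgen : GenericParams (paramsM q g yp ym) q)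
    (hε : SmallRadius (paramsM q g yp ym) q ε) (c : ℂ) (f₁ f₂ : Laurent3) :
    opM q g ε (evalL (c • f₁ + f₂)) x yp ym =
      c * opM q g ε (evalL f₁) x yp ym + opM q g ε (evalL f₂) x yp ym := by
  have hc : ∀ f : Laurent3, ∀ z, z ≠ 0 → z ∉ denominatorZeros (paramsM q g yp ym) q →
      ContinuousAt (fun t => t⁻¹ * awWeight (paramsM q g yp ym) q t *
        evalL f ![tPlus q g yp * x * t, tPlus q g yp * x * t⁻¹, x]) z := fun f z h0 hz =>
    (analyticAt_inv_mul_awWeight hq0 hq1 h0 hz).continuousAt.mul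
      (continuousAt_evalL f _ x h0 (mul_ne_zero (tPlus_ne_zero hq0 g hyp) hx))
  have h := cycleIntegral_add hq0 hq1 hgen hε
    (F := fun t => c * (t⁻¹ * awWeight (paramsM q g yp ym) q t *
      evalL f₁ ![tPlus q g yp * x * t, tPlus q g yp * x * t⁻¹, x]))
    (fun z h0 hz => (continuousAt_const (y := c)).mul (hc f₁ z h0 hz)) (hc f₂)
  rw [cycleIntegral_const_mul] at h
  simp only [opM_eq hq0, evalL_add, evalL_smul]
  have e : ∀ w a b : ℂ, w * (c * a + b) = c * (w * a) + w * b := fun w a b => by ring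
  simp only [e]
  rw [h]
  ring

/-- The operator is diagonal: on `p_{jkν}` the integrand is, up to a monomial, the weight with the
third parameter multiplied by `q^ν`. -/
theorem opM_pT {q g ε : ℝ} (hq0 : 0 < q) (hq1 : q < 1) (hg : 0 < g) {x yp ym : ℂ} (hx : x ≠ 0)
    (hyp : yp ≠ 0) (hym : ym ≠ 0) (hgen : GenericParams (paramsM q g yp ym) q)
    (hε : SmallRadius (paramsM q g yp ym) q ε) (j k : ℤ) (ν : ℕ) :
    opM q g ε (evalL (pT q g j k ν)) x yp ym =
      ((ell q g : ℂ) ^ (3 * k)) *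
        (qPoch (((ell q g : ℂ)⁻¹) ^ 2) q ν / qPoch (((ell q g : ℂ)⁻¹) ^ 3) q ν) *
        evalL (pY q j k ν) ![yp * ym, yp / ym, x] := by
  obtain ⟨e01, e23, e02, e12⟩ := paramsM_mul hq0 g hyp hym
  have hK := kernelConst_eq hq0 hq1 hg hyp hym
  have hT := tPlus_ne_zero hq0 g hyp
  have h2g : (((ell q g : ℂ)⁻¹) ^ 2) = ((q ^ (2 * g) : ℝ) : ℂ) := by
    rw [ell_inv hq0, pow_two, cast_rpow_mul hq0]
    ring_nf
  have h3g : (((ell q g : ℂ)⁻¹) ^ 3) = ((q ^ (3 * g) : ℝ) : ℂ) := by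
    rw [pow_succ, h2g, ell_inv hq0, cast_rpow_mul hq0]
    ring_nf
  have hTk : (tPlus q g yp) ^ 2 = (ell q g : ℂ) ^ 3 * ((yp * ym) * (yp / ym)) := by
    have h := cast_rpow_mul hq0 (-g * (3 / 2)) (-g * (3 / 2))
    have h' : ((q ^ (-g * (3 / 2) + -g * (3 / 2)) : ℝ) : ℂ) = (ell q g : ℂ) ^ 3 := by
      rw [ell, ← Complex.ofReal_pow, ← Real.rpow_natCast, ← Real.rpow_mul hq0.le]
      norm_num
      ring_nf
    rw [h'] at h
    rw [tPlus, ell_rpow hq0, ← h]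
    field_simp
  have h2 : paramsM q g yp ym 2 = (ell q g : ℂ)⁻¹ * tPlus q g yp := by
    rw [ell_inv hq0]
    simp only [paramsM, cycleParams, Matrix.cons_val]
    rw [show 2 * g / 2 = g by ring, mul_comm]
  have e4 : paramsM q g yp ym 0 * paramsM q g yp ym 1 * paramsM q g yp ym 2 * paramsM q g yp ym 3 =
      ((q ^ (3 * g) : ℝ) : ℂ) := by
    rw [mul_assoc, e01, e23, cast_rpow_mul hq0]
    ring_nf
  have hn3 : ‖((q ^ (3 * g) : ℝ) : ℂ)‖ < 1 := by
    rw [Complex.norm_real, Real.norm_of_nonneg (Real.rpow_pos_of_pos hq0 _).le]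
    exact Real.rpow_lt_one hq0.le hq1 (by linarith)
  rw [opM_eq hq0]
  set prm := paramsM q g yp ym with hprm
  set T := tPlus q g yp with hTdef
  set prm' := Function.update prm 2 (prm 2 * (q : ℂ) ^ ν) with hprm'
  have hsub : innerPoles prm' q ⊆ innerPoles prm q := innerPoles_update_subset prm q 2 ν
  have hgen' : GenericParams prm' q := hgen.of_subset hsub
  -- At the poles the two integrands differ (by the convention for division by zero), but the cycle
  -- avoids them.
  have hcong : cycleIntegral prm q ε (fun t => t⁻¹ * awWeight prm q t *
        evalL (pT q g j k ν) ![T * x * t, T * x * t⁻¹, x]) =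
      cycleIntegral prm q ε fun t => (x ^ j * (T ^ 2) ^ k) * (t⁻¹ * awWeight prm' q t) := by
    refine cycleIntegral_congr hgen hε fun t ht0 ht => ?_
    rw [evalL_pT, awWeight_update hq0 hq1 2 ν ht, h2]
    · simp only [Matrix.cons_val]
      have a1 : (ell q g : ℂ)⁻¹ * (T * x * t * x⁻¹) = (ell q g : ℂ)⁻¹ * T * t := by field_simp
      have a2 : (ell q g : ℂ)⁻¹ * (T * x * t⁻¹ * x⁻¹) = (ell q g : ℂ)⁻¹ * T * t⁻¹ := by field_simp
      have a3 : (T * x * t) ^ k * (T * x * t⁻¹) ^ k * x ^ (j - 2 * k) = x ^ j * (T ^ 2) ^ k := by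
        rw [← mul_zpow, show T * x * t * (T * x * t⁻¹) = T ^ 2 * x ^ 2 by field_simp, mul_zpow,
          zpow_sub₀ hx, zpow_mul]
        have : (x ^ (2 : ℤ)) ^ k ≠ 0 := zpow_ne_zero _ (zpow_ne_zero _ hx)
        field_simp
      rw [a1, a2, a3]
      ring
    · intro i
      fin_cases i
      · exact mul_ne_zero (mul_ne_zero hT hx) ht0
      · exact mul_ne_zero (mul_ne_zero hT hx) (inv_ne_zero ht0)
      · exact hx
  have hcyc : cycleIntegral prm q ε (fun t => t⁻¹ * awWeight prm' q t) =
      cycleRes prm' q (fun t => t⁻¹ * awWeight prm' q t) := by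
    rw [cycleIntegral_eq_cycleRes hε fun z h0 hz => (analyticAt_inv_mul_awWeight hq0 hq1 h0
        fun h => hz (denominatorZeros_subset hsub h)).differentiableAt,
      cycleRes_eq_of_subset hq0 hq1 hgen hsub fun z h0 hz =>
        analyticAt_inv_mul_awWeight hq0 hq1 h0 hz]
  have e4' : prm' 0 * prm' 1 * prm' 2 * prm' 3 = ((q ^ (3 * g) : ℝ) : ℂ) * (q : ℂ) ^ ν := by
    rw [← e4]
    simp [hprm']
    ring
  have hn3' : ‖((q ^ (3 * g) : ℝ) : ℂ) * (q : ℂ) ^ ν‖ < 1 := by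
    rw [norm_mul, norm_pow]
    exact mul_lt_one_of_nonneg_of_lt_one_left (norm_nonneg _) hn3
      (pow_le_one₀ (norm_nonneg _) (norm_ofReal_lt_one hq0 hq1).le)
  have hAW := cycleRes_awWeight hq0 hq1 hgen' (by rw [e4']; exact hn3')
  rw [e4'] at hAW
  have hq : qPochInf q q ≠ 0 :=
    qPochInf_ne_zero_of_norm_lt_one hq0 hq1 (norm_ofReal_lt_one hq0 hq1)
  have hP0 : pairProd prm' q ≠ 0 := by
    have h := fun i l => qPochInf_ne_zero hq0 hq1 (hgen'.2 i l)
    exact mul_ne_zero (mul_ne_zero (mul_ne_zero (mul_ne_zero (mul_ne_zero (h 0 1) (h 0 2)) (h 0 3))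
      (h 1 2)) (h 1 3)) (h 2 3)
  -- The pairs containing the shifted parameter have the products `y₁`, `y₂` and `ℓ⁻²`.
  have hP : pairProd prm q = qPoch (yp * ym) q ν * qPoch (yp / ym) q ν *
      qPoch ((q ^ (2 * g) : ℝ) : ℂ) q ν * pairProd prm' q := by
    have a1 := qPochInf_eq_qPoch_mul hq0 hq1 (prm 0 * prm 2) ν
    have a2 := qPochInf_eq_qPoch_mul hq0 hq1 (prm 1 * prm 2) ν
    have a3 := qPochInf_eq_qPoch_mul hq0 hq1 (prm 2 * prm 3) ν
    rw [← e02, ← e12, ← e23, pairProd, a1, a2, a3, pairProd]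
    simp only [hprm', Function.update_self, ne_eq, Function.update_of_ne, not_false_eq_true,
      (by decide : (0 : Fin 4) ≠ 2), (by decide : (1 : Fin 4) ≠ 2), (by decide : (3 : Fin 4) ≠ 2),
      ← mul_assoc, mul_right_comm (prm 2) ((q : ℂ) ^ ν) (prm 3)]
    ring
  have h3 := qPochInf_eq_qPoch_mul hq0 hq1 ((q ^ (3 * g) : ℝ) : ℂ) ν
  have hne3 := qPochInf_ne_zero_of_norm_lt_one hq0 hq1 hn3
  rw [h3] at hne3 hK
  have m1 := left_ne_zero_of_mul hne3
  have m2 := right_ne_zero_of_mul hne3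
  have hpi : 2 * (Real.pi : ℂ) * Complex.I ≠ 0 := Complex.two_pi_I_ne_zero
  rw [hcong, cycleIntegral_const_mul, hcyc, evalL_pY, h2g, h3g, hTk]
  · simp only [Matrix.cons_val]
    rw [← eq_div_iff (mul_ne_zero hq hP0)] at hAW
    rw [← eq_div_iff (mul_ne_zero two_ne_zero hne3), hP] at hK
    have hl : (ell q g : ℂ) ^ (3 * k) = ((ell q g : ℂ) ^ 3) ^ k := by
      rw [zpow_mul]
      norm_cast
    rw [hAW, hK, hl, mul_zpow, mul_zpow]
    generalize qPoch ((q ^ (3 * g) : ℝ) : ℂ) q ν = X at *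
    generalize qPoch ((q ^ (2 * g) : ℝ) : ℂ) q ν = Y at *
    generalize qPochInf (((q ^ (3 * g) : ℝ) : ℂ) * (q : ℂ) ^ ν) q = Z at *
    generalize (yp * ym) ^ k = A at *
    generalize (yp / ym) ^ k = B at *
    generalize qPoch (yp / ym) q ν = D at *
    generalize pairProd prm' q = E at *
    field_simp
  · intro i
    fin_cases i
    · exact mul_ne_zero hyp hym
    · exact div_ne_zero hyp hym
    · exact hx

/-! ### The bases -/

/-- A family that is triangular, with nonzero diagonal entries, in injective coordinates indexed by
the same set is a basis. -/
theorem exists_basis_of_triangular {K M ι : Type*} [Field K] [AddCommGroup M] [Module K M]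
    (v : ι → M) (φ : M →ₗ[K] ι →₀ K) (hφ : Function.Injective φ) (r : ι → ℕ)
    (hd : ∀ i, φ (v i) i ≠ 0) (ht : ∀ i j, φ (v i) j ≠ 0 → j = i ∨ r j < r i) :
    ∃ b : Module.Basis ι K M, ∀ i, b i = v i := by
  classical
  set L := Finsupp.linearCombination K v with hL
  have hinj : Function.Injective L := by
    rw [injective_iff_map_eq_zero]
    intro x hx
    by_contra hne
    -- Look at the coordinate of a term of maximal rank.
    obtain ⟨i, hi, hmax⟩ := x.support.exists_max_image r (Finsupp.support_nonempty_iff.mpr hne)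
    have h1 : φ (L x) i = x i * φ (v i) i := by
      rw [hL, Finsupp.linearCombination_apply, Finsupp.sum, map_sum, Finsupp.finsetSum_apply,
        Finset.sum_eq_single i]
      · simp
      · intro j hj hji
        rw [map_smul, Finsupp.smul_apply, smul_eq_mul]
        by_contra h
        rcases ht j i (right_ne_zero_of_mul h) with h | h
        · exact hji h.symm
        · exact (hmax j hj).not_gt h
      · exact fun h => absurd hi h
    rw [hx, map_zero, Finsupp.zero_apply] at h1
    exact mul_ne_zero (Finsupp.mem_support_iff.mp hi) (hd i) h1.symm
  have hmem : ∀ n i, r i = n → Finsupp.single i (1 : K) ∈ LinearMap.range (φ ∘ₗ L) := by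
    intro n
    induction n using Nat.strong_induction_on with
    | _ n ih =>
      intro i hi
      have hvi : φ (v i) ∈ LinearMap.range (φ ∘ₗ L) := ⟨Finsupp.single i 1, by simp [hL]⟩
      have hrest : ∑ j ∈ (φ (v i)).support.erase i, Finsupp.single j (φ (v i) j) ∈
          LinearMap.range (φ ∘ₗ L) := by
        refine Submodule.sum_mem _ fun j hj => ?_
        obtain ⟨hji, hj⟩ := Finset.mem_erase.mp hj
        have hlt := (ht i j (Finsupp.mem_support_iff.mp hj)).resolve_left hji
        have := Submodule.smul_mem _ (φ (v i) j) (ih (r j) (hi ▸ hlt) j rfl)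
        simpa using this
      have hsum : φ (v i) = Finsupp.single i (φ (v i) i) +
          ∑ j ∈ (φ (v i)).support.erase i, Finsupp.single j (φ (v i) j) := by
        rw [Finset.add_sum_erase _ (fun j => Finsupp.single j (φ (v i) j))
          (Finsupp.mem_support_iff.mpr (hd i))]
        exact (Finsupp.sum_single (φ (v i))).symm
      have h2 : Finsupp.single i (φ (v i) i) ∈ LinearMap.range (φ ∘ₗ L) := by
        rw [← sub_eq_iff_eq_add] at hsum
        have := Submodule.sub_mem _ hvi hrest
        rwa [hsum] at this
      have h3 := Submodule.smul_mem _ (φ (v i) i)⁻¹ h2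
      simpa [hd i] using h3
  have hsurj : Function.Surjective L := by
    intro f
    have hf : φ f ∈ LinearMap.range (φ ∘ₗ L) := by
      rw [← Finsupp.sum_single (φ f)]
      refine Submodule.sum_mem _ fun j _ => ?_
      have := Submodule.smul_mem _ (φ f j) (hmem _ j rfl)
      simpa using this
    obtain ⟨x, hx⟩ := hf
    exact ⟨x, hφ hx⟩
  refine ⟨Module.Basis.ofRepr (LinearEquiv.ofBijective L ⟨hinj, hsurj⟩).symm, fun i => ?_⟩
  simp [Module.Basis.coe_ofRepr, hL]

lemma coeff_mono_mul (a' b' c' : ℤ) (f : Laurent3) (a b c : ℤ) :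
    (mono a' b' c' * f).coeff ![a, b, c] = f.coeff ![a - a', b - b', c - c'] := by
  rw [mono, AddMonoidAlgebra.coeff_single_mul_apply, one_mul]
  congr 1
  ext i
  fin_cases i <;> simp <;> ring

/-- The product `∏_{i<n} (1 - c_i z₀ z₂^d)(1 - c_i z₁ z₂^d)`. -/
def symProd (d : ℤ) (c : ℕ → ℂ) (n : ℕ) : Laurent3 :=
  ∏ i ∈ Finset.range n, ((1 - c i • mono 1 0 d) * (1 - c i • mono 0 1 d))

lemma coeff_symProd_zero (d : ℤ) (c : ℕ → ℂ) (x y z : ℤ) :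
    (symProd d c 0).coeff ![x, y, z] = if x = 0 ∧ y = 0 ∧ z = 0 then 1 else 0 := by
  classical
  rw [symProd, Finset.prod_range_zero, AddMonoidAlgebra.one_def, AddMonoidAlgebra.coeff_single,
    Finsupp.single_apply]
  refine if_congr ?_ rfl rfl
  constructor
  · intro h
    exact ⟨(congrFun h 0).symm, (congrFun h 1).symm, (congrFun h 2).symm⟩
  · rintro ⟨rfl, rfl, rfl⟩
    ext i
    fin_cases i <;> rfl

lemma coeff_symProd_succ (d : ℤ) (c : ℕ → ℂ) (n : ℕ) (x y z : ℤ) :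
    (symProd d c (n + 1)).coeff ![x, y, z] = (symProd d c n).coeff ![x, y, z] -
      c n * (symProd d c n).coeff ![x - 1, y, z - d] -
      c n * (symProd d c n).coeff ![x, y - 1, z - d] +
      c n ^ 2 * (symProd d c n).coeff ![x - 1, y - 1, z - d - d] := by
  have h : symProd d c (n + 1) = symProd d c n - c n • (mono 1 0 d * symProd d c n) -
      c n • (mono 0 1 d * symProd d c n) +
      (c n ^ 2) • (mono 1 0 d * (mono 0 1 d * symProd d c n)) := by
    rw [symProd, Finset.prod_range_succ, ← symProd]
    simp only [Algebra.smul_def, map_pow]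
    ring
  rw [h]
  simp only [AddMonoidAlgebra.coeff_add, AddMonoidAlgebra.coeff_sub, AddMonoidAlgebra.coeff_smul,
    Finsupp.add_apply, Finsupp.sub_apply, Finsupp.smul_apply, coeff_mono_mul, smul_eq_mul, sub_zero]

lemma coeff_symProd_symm (d : ℤ) (c : ℕ → ℂ) (n : ℕ) : ∀ x y z : ℤ,
    (symProd d c n).coeff ![x, y, z] = (symProd d c n).coeff ![y, x, z] := by
  induction n with
  | zero =>
    intro x y z
    simp only [coeff_symProd_zero]
    refine if_congr ?_ rfl rfl
    tauto
  | succ n ih =>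
    intro x y z
    rw [coeff_symProd_succ, coeff_symProd_succ, ih x y, ih (x - 1) y, ih x (y - 1),
      ih (x - 1) (y - 1)]
    ring

/-- The exponents of `z₀` and `z₁` in the product differ by at most the number of factors. -/
lemma coeff_symProd_eq_zero (d : ℤ) (c : ℕ → ℂ) (n : ℕ) : ∀ x y z : ℤ, n < x - y →
    (symProd d c n).coeff ![x, y, z] = 0 := by
  induction n with
  | zero =>
    intro x y z h
    rw [coeff_symProd_zero, if_neg]
    push_cast at h
    omega
  | succ n ih =>
    intro x y z h
    push_cast at h
    rw [coeff_symProd_succ, ih x y z (by omega), ih (x - 1) y _ (by omega),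
      ih x (y - 1) _ (by omega), ih (x - 1) (y - 1) _ (by omega)]
    ring

/-- Only the monomial `(z₀ z₂^d)^n` attains the maximal difference of exponents. -/
lemma coeff_symProd_of_sub_eq (d : ℤ) (c : ℕ → ℂ) (n : ℕ) : ∀ x y z : ℤ, x - y = n →
    (symProd d c n).coeff ![x, y, z] =
      if y = 0 ∧ z = d * n then ∏ i ∈ Finset.range n, (-c i) else 0 := by
  induction n with
  | zero =>
    intro x y z h
    rw [coeff_symProd_zero]
    push_cast at h
    refine if_congr ?_ (by simp) rfl
    push_cast
    rw [mul_zero]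
    omega
  | succ n ih =>
    intro x y z h
    push_cast at h
    rw [coeff_symProd_succ, coeff_symProd_eq_zero d c n x y z (by omega),
      coeff_symProd_eq_zero d c n x (y - 1) _ (by omega),
      coeff_symProd_eq_zero d c n (x - 1) (y - 1) _ (by omega), ih (x - 1) y _ (by omega),
      Finset.prod_range_succ]
    have hiff : (y = 0 ∧ z - d = d * n) ↔ (y = 0 ∧ z = d * ((n + 1 : ℕ) : ℤ)) := by
      push_cast
      rw [mul_add, mul_one, sub_eq_iff_eq_add]
    by_cases hc : y = 0 ∧ z - d = d * n
    · rw [if_pos hc, if_pos (hiff.mp hc)]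
      ring
    · rw [if_neg hc, if_neg (fun h => hc (hiff.mpr h))]
      ring

lemma mono_mul_symProd_mem (d : ℤ) (c : ℕ → ℂ) (k m : ℤ) (n : ℕ) :
    mono k k m * symProd d c n ∈ Sym12 := fun x y z => by
  rw [coeff_mono_mul, coeff_mono_mul, coeff_symProd_symm]

/-- The products `(z₀z₁)^k z₂^m ∏_{i<ν} (1 - c_i z₀ z₂^d)(1 - c_i z₁ z₂^d)` form a basis: they are
triangular with respect to the coefficients of `z₀^{k+ν} z₁^k z₂^{m+dν}`, `ν ≥ 0`, which
determine a symmetric Laurent polynomial. -/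
theorem exists_basis_symProd (d : ℤ) (c : ℕ → ℂ) (hc : ∀ i, c i ≠ 0) (m : ℤ → ℤ → ℤ)
    (hm : ∀ k, Function.Bijective fun j => m j k) :
    ∃ b : Module.Basis (ℤ × ℤ × ℕ) ℂ Sym12, ∀ (j k : ℤ) (ν : ℕ),
      (b (j, k, ν) : Laurent3) = mono k k (m j k) * symProd d c ν := by
  set e : ℤ × ℤ × ℕ → Fin 3 → ℤ :=
    fun i => ![i.2.1 + i.2.2, i.2.1, m i.1 i.2.1 + d * i.2.2] with he
  have heinj : Function.Injective e := by
    rintro ⟨j, k, ν⟩ ⟨j', k', ν'⟩ h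
    have h0 : k + ν = k' + ν' := congrFun h 0
    have h1 : k = k' := congrFun h 1
    have h2 : m j k + d * ν = m j' k' + d * ν' := congrFun h 2
    subst h1
    have h3 : ν = ν' := by omega
    subst h3
    have h4 : j = j' := (hm k).1 (by simpa using h2)
    rw [h4]
  let φ : Sym12 →ₗ[ℂ] (ℤ × ℤ × ℕ) →₀ ℂ :=
    { toFun := fun f => (f : Laurent3).coeff.comapDomain e heinj.injOn
      map_add' := fun f f' => by ext i; simp
      map_smul' := fun a f => by ext i; simp }
  have hφ : ∀ (f : Sym12) (i : ℤ × ℤ × ℕ), φ f i = (f : Laurent3).coeff (e i) := fun f i => rfl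
  have hφinj : Function.Injective φ := by
    rw [injective_iff_map_eq_zero]
    intro f hf
    have h1 : ∀ x y z : ℤ, y ≤ x → (f : Laurent3).coeff ![x, y, z] = 0 := by
      intro x y z hxy
      obtain ⟨j, hj⟩ := (hm y).2 (z - d * (x - y).toNat)
      have h2 := hφ f (j, y, (x - y).toNat)
      rw [hf, he] at h2
      simp only at hj h2
      rw [hj, sub_add_cancel, show y + ((x - y).toNat : ℤ) = x by omega] at h2
      exact h2.symm
    refine Subtype.ext (AddMonoidAlgebra.coeff_injective (Finsupp.ext fun n => ?_))
    have hn : n = ![n 0, n 1, n 2] := by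
      ext i
      fin_cases i <;> rfl
    rw [hn]
    rcases le_total (n 1) (n 0) with h | h
    · exact h1 _ _ _ h
    · rw [f.2 (n 0) (n 1) (n 2)]
      exact h1 _ _ _ h
  obtain ⟨b, hb⟩ := exists_basis_of_triangular
    (fun i : ℤ × ℤ × ℕ => (⟨_, mono_mul_symProd_mem d c i.2.1 (m i.1 i.2.1) i.2.2⟩ : Sym12))
    φ hφinj (fun i => i.2.2)
    (by
      rintro ⟨j, k, ν⟩
      rw [hφ]
      simp only [he, coeff_mono_mul]
      rw [coeff_symProd_of_sub_eq _ _ _ _ _ _ (by ring), if_pos (by constructor <;> ring)]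
      exact Finset.prod_ne_zero_iff.mpr fun i _ => neg_ne_zero.mpr (hc i))
    (by
      rintro ⟨j, k, ν⟩ ⟨j', k', ν'⟩ h
      rw [hφ] at h
      simp only [he, coeff_mono_mul] at h
      rcases lt_trichotomy ν' ν with hlt | rfl | hlt
      · exact Or.inr hlt
      · rw [coeff_symProd_of_sub_eq _ _ _ _ _ _ (by ring)] at h
        have h' := (ite_ne_right_iff.mp h).1
        have hk : k' = k := by omega
        subst hk
        have hj : j' = j := (hm k').1 (by
          have := h'.2
          simp only
          linarith)
        exact Or.inl (by rw [hj])
      · exact absurd (coeff_symProd_eq_zero _ _ _ _ _ _ (by omega)) h)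
  exact ⟨b, fun j k ν => by rw [hb]⟩

lemma pT_eq (q g : ℝ) (j k : ℤ) (ν : ℕ) :
    pT q g j k ν = mono k k (j - 2 * k) *
      symProd (-1) (fun i => (q : ℂ) ^ i * (ell q g : ℂ)⁻¹) ν := by
  simp only [pT, symProd, qPoch, ← Finset.prod_mul_distrib, smul_smul]

lemma pY_eq (q : ℝ) (j k : ℤ) (ν : ℕ) :
    pY q j k ν = mono k k j * symProd 0 (fun i => (q : ℂ) ^ i) ν := by
  simp only [pY, symProd, qPoch, ← Finset.prod_mul_distrib]

end RuijsenaarsA2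

end

open RuijsenaarsA2
theorem mainTheorem2 (q g : ℝ) (hq0 : 0 < q) (hq1 : q < 1) (hg : 0 < g) :
    ∃ (b b' : Module.Basis (ℤ × ℤ × ℕ) ℂ Sym12) (T : Sym12 →ₗ[ℂ] Sym12),
      (∀ (j k : ℤ) (ν : ℕ), (b (j, k, ν) : Laurent3) = pT q g j k ν) ∧
      (∀ (j k : ℤ) (ν : ℕ), (b' (j, k, ν) : Laurent3) = pY q j k ν) ∧
      (∀ (f : Sym12) (x yp ym : ℂ) (ε : ℝ), x ≠ 0 → yp ≠ 0 → ym ≠ 0 →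
        GenericParams (paramsM q g yp ym) q → SmallRadius (paramsM q g yp ym) q ε →
        opM q g ε (evalL f) x yp ym = evalL (T f) ![yp * ym, yp / ym, x]) ∧
      (∀ (j k : ℤ) (ν : ℕ),
        T (b (j, k, ν)) =
          (((ell q g : ℂ) ^ (3 * k)) *
            (qPoch (((ell q g : ℂ)⁻¹) ^ 2) q ν / qPoch (((ell q g : ℂ)⁻¹) ^ 3) q ν)) •
            b' (j, k, ν)) := by
  have hq : ∀ i : ℕ, (q : ℂ) ^ i ≠ 0 := fun i => pow_ne_zero _ (by exact_mod_cast hq0.ne')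
  have hl : (ell q g : ℂ)⁻¹ ≠ 0 := by
    rw [ell_inv hq0]
    exact_mod_cast (Real.rpow_pos_of_pos hq0 g).ne'
  obtain ⟨b, hb⟩ := exists_basis_symProd (-1) (fun i => (q : ℂ) ^ i * (ell q g : ℂ)⁻¹)
    (fun i => mul_ne_zero (hq i) hl) (fun j k => j - 2 * k)
    (fun k => (Equiv.subRight (2 * k)).bijective)
  obtain ⟨b', hb'⟩ := exists_basis_symProd 0 (fun i => (q : ℂ) ^ i) hq (fun j _ => j)
    (fun _ => Function.bijective_id)
  have hbT : ∀ (j k : ℤ) (ν : ℕ), (b (j, k, ν) : Laurent3) = pT q g j k ν := fun j k ν => by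
    rw [hb, pT_eq]
  have hbY : ∀ (j k : ℤ) (ν : ℕ), (b' (j, k, ν) : Laurent3) = pY q j k ν := fun j k ν => by
    rw [hb', pY_eq]
  set T : Sym12 →ₗ[ℂ] Sym12 := b.constr ℂ fun i => (((ell q g : ℂ) ^ (3 * i.2.1)) *
    (qPoch (((ell q g : ℂ)⁻¹) ^ 2) q i.2.2 / qPoch (((ell q g : ℂ)⁻¹) ^ 3) q i.2.2)) • b' i with hT
  have hTb : ∀ (j k : ℤ) (ν : ℕ), T (b (j, k, ν)) = (((ell q g : ℂ) ^ (3 * k)) *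
      (qPoch (((ell q g : ℂ)⁻¹) ^ 2) q ν / qPoch (((ell q g : ℂ)⁻¹) ^ 3) q ν)) •
      b' (j, k, ν) := fun j k ν => by
    rw [hT, Module.Basis.constr_basis]
  refine ⟨b, b', T, hbT, hbY, fun f x yp ym ε hx hyp hym hgen hε => ?_, hTb⟩
  have hadd := opM_add_smul hq0 hq1 hx hyp hgen hε
  have hzero : opM q g ε (evalL 0) x yp ym = 0 := by
    have := hadd 1 0 0
    simpa using this
  -- Both sides are linear in `f`.
  let Φ : Sym12 →ₗ[ℂ] ℂ :=
    { toFun := fun f => opM q g ε (evalL f) x yp ym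
      map_add' := fun f f' => by simpa using hadd 1 f f'
      map_smul' := fun a f => by simpa [hzero] using hadd a f 0 }
  let Ξ : Sym12 →ₗ[ℂ] ℂ :=
    { toFun := fun f => evalL (T f) ![yp * ym, yp / ym, x]
      map_add' := fun f f' => by rw [map_add, Submodule.coe_add, evalL_add]
      map_smul' := fun a f => by
        rw [map_smul, Submodule.coe_smul, evalL_smul, RingHom.id_apply, smul_eq_mul] }
  have hΦΞ : Φ = Ξ := by
    refine b.ext ?_
    rintro ⟨j, k, ν⟩
    change opM q g ε (evalL (b (j, k, ν) : Laurent3)) x yp ym =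
      evalL (T (b (j, k, ν)) : Laurent3) ![yp * ym, yp / ym, x]
    rw [hTb, hbT, Submodule.coe_smul, evalL_smul, hbY]
    exact opM_pT hq0 hq1 hg hx hyp hym hgen hε j k ν
  exact congrArg (fun F : Sym12 →ₗ[ℂ] ℂ => F f) hΦΞ
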